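/- Let $N\ge 2$ be an integer, $1<p<N$, $m>0$, $0\le\mu<\bar\mu:=\left(\frac{N-p}{p}\right)^p$ and $p^*=\frac{Np}{N-p}$. Let $f:\mathbb{R}\to\mathbb{R}$ be continuous and suppose that, for some $q>p$ and some constant $A>0$, $$\limsup_{t\to0}\frac{|f(t)|}{|t|^{q-1}}\le A\qquad\text{and}\qquad \limsup_{|t|\to\infty}\frac{|f(t)|}{|t|^{p^*-1}}\le A .$$ Let $u\in W^{1,p}(\mathbb{R}^N)$ be a weak solution, positive almost everywhere and equal almost everywhere to a radial function, of $$-\Delta_p u-\frac{\mu}{|x|^p}|u|^{p-2}u+m|u|^{p-2}u=f(u)\quad\text{in }\mathbb{R}^N,$$ where $\Delta_p u=\operatorname{div}(|\nabla u|^{p-2}\nabla u)$; that is, for every nonnegative $\varphi\in C_0^\infty(\mathbb{R}^N)$, $$\int_{\mathbb{R}^N}\Big(|\nabla u|^{p-2}\nabla u\cdot\nabla\varphi-\frac{\mu}{|x|^p}|u|^{p-2}u\varphi+m|u|^{p-2}u\varphi\Big)=\int_{\mathbb{R}^N}f(u)\varphi .$$ Then, after modification on a set of measure zero, $u$ is continuous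 on $\mathbb{R}^N\setminus\{0\}$, and for this representative $$\lim_{|x|\to\infty}u(x)\,|x|^{\frac{N-1}{p(p-1)}}\,e^{\left(\frac{m}{p-1}\right)^{1/p}|x|}=C$$ for a constant $0<C<\infty$. -/

import Mathlib

open MeasureTheory Filter Topology
open scoped ContDiff

/-- `φ ∈ C₀^∞(ℝᴺ)`: smooth with compact support. -/
def IsTestFunction {N : ℕ} (φ : EuclideanSpace ℝ (Fin N) → ℝ) : Prop :=
  ContDiff ℝ ∞ φ ∧ HasCompactSupport φ

/-- `G` is the weak gradient of `u` on `ℝᴺ`: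
`∫ u ∂ᵢφ = - ∫ Gᵢ φ` for every test function `φ` and every coordinate `i`. -/
def HasWeakGradient {N : ℕ} (u : EuclideanSpace ℝ (Fin N) → ℝ)
    (G : EuclideanSpace ℝ (Fin N) → EuclideanSpace ℝ (Fin N)) : Prop :=
  ∀ φ : EuclideanSpace ℝ (Fin N) → ℝ, IsTestFunction φ → ∀ i : Fin N,
    ∫ x, u x * fderiv ℝ φ x (EuclideanSpace.single i 1) = - ∫ x, G x i * φ x

/-- `u ∈ W^{1,p}(ℝᴺ)` with weak gradient `G` (which is unique up to null sets). -/
structure MemW1p {N : ℕ} (p : ℝ) (u : EuclideanSpace ℝ (Fin N) → ℝ)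
    (G : EuclideanSpace ℝ (Fin N) → EuclideanSpace ℝ (Fin N)) : Prop where
  memLp : MemLp u (ENNReal.ofReal p) volume
  memLp_grad : MemLp G (ENNReal.ofReal p) volume
  hasWeakGradient : HasWeakGradient u G

/-- The form
`∫ (|∇u|^{p-2} ∇u · ∇φ - μ |x|^{-p} |u|^{p-2} u φ + m |u|^{p-2} u φ)`, where `G = ∇u`. -/
noncomputable def hardyForm {N : ℕ} (p μ m : ℝ) (u : EuclideanSpace ℝ (Fin N) → ℝ)
    (G : EuclideanSpace ℝ (Fin N) → EuclideanSpace ℝ (Fin N))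
    (φ : EuclideanSpace ℝ (Fin N) → ℝ) : ℝ :=
  ∫ x, (‖G x‖ ^ (p - 2) * inner ℝ (G x) (gradient φ x)
    - μ / ‖x‖ ^ p * |u x| ^ (p - 2) * u x * φ x
    + m * |u x| ^ (p - 2) * u x * φ x)

/-- `u ∈ W^{1,p}(ℝᴺ)` is a weak subsolution of
`-Δ_p u - μ |x|^{-p} |u|^{p-2} u + m |u|^{p-2} u = f(u)` in `ℝᴺ`. -/
def IsWeakSubsolution {N : ℕ} (p μ m : ℝ) (f : ℝ → ℝ)
    (u : EuclideanSpace ℝ (Fin N) → ℝ) : Prop :=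
  ∃ G : EuclideanSpace ℝ (Fin N) → EuclideanSpace ℝ (Fin N), MemW1p p u G ∧
    ∀ φ : EuclideanSpace ℝ (Fin N) → ℝ, IsTestFunction φ → (∀ x, 0 ≤ φ x) →
      hardyForm p μ m u G φ ≤ ∫ x, f (u x) * φ x

/-- `u ∈ W^{1,p}(ℝᴺ)` is a weak supersolution of
`-Δ_p u - μ |x|^{-p} |u|^{p-2} u + m |u|^{p-2} u = f(u)` in `ℝᴺ`. -/
def IsWeakSupersolution {N : ℕ} (p μ m : ℝ) (f : ℝ → ℝ)
    (u : EuclideanSpace ℝ (Fin N) → ℝ) : Prop :=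
  ∃ G : EuclideanSpace ℝ (Fin N) → EuclideanSpace ℝ (Fin N), MemW1p p u G ∧
    ∀ φ : EuclideanSpace ℝ (Fin N) → ℝ, IsTestFunction φ → (∀ x, 0 ≤ φ x) →
      ∫ x, f (u x) * φ x ≤ hardyForm p μ m u G φ

/-- A weak solution is both a weak subsolution and a weak supersolution. -/
def IsWeakSolution {N : ℕ} (p μ m : ℝ) (f : ℝ → ℝ)
    (u : EuclideanSpace ℝ (Fin N) → ℝ) : Prop :=
  IsWeakSubsolution p μ m f u ∧ IsWeakSupersolution p μ m f u

/-- The class of `u` contains a radial function. -/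
def IsRadialAE {N : ℕ} (u : EuclideanSpace ℝ (Fin N) → ℝ) : Prop :=
  ∃ g : ℝ → ℝ, ∀ᵐ x, u x = g ‖x‖

/-! A positive radial solution has a profile g(r) with flux w = |g'|^{p-2} g' satisfying w' =
-(N-1)/r w + (m - μ/r^p) g^{p-1} - f(g). With α = 1/(p-1), k = N-1 and z = -w g^{1-p}, which is
(-g'/g)^{p-1} once w is negative, this second order equation becomes the first order Riccati
equation z' = z^{1+α}/α - (k/r) z - M, where M = m - μ/r^p - f(g) g^{1-p} tends to m because q > p
and g tends to 0.

The limiting equation has one positive equilibrium c, given by c^{1+α} = αm, and it is unstable: a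
solution staying below it is driven to zero, one staying above it blows up at finite radius. A
positive global solution can do neither, so z tends to c (`riccati_tendsto`). Hence -g'/g tends to
c^α = (m/(p-1))^{1/p}, g decays exponentially, and the contribution of f to M becomes smaller than
every power of r. Thus M = m + O(r^{-s}) with s = min(p, 2) > 1. The same instability, now for the
linearised equation, gives z = c + d/r + O(r^{-s}) (`riccati_expansion`). So -g'/g is c^α + b/r up
to an integrable error, with b = (N-1)/(p(p-1)), and integrating log g gives the limit, positive as
an exponential (`tendsto_of_riccati`, `tendsto_of_radial_ode`).

The remaining work justifies the differential equation. Testing the weak gradient with the fields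
ψ(|x|) x shows that the profile is absolutely continuous, and the weak gradient is then radial
(`HasWeakGradient.exists_profile_eq_primitive`, `HasWeakGradient.ae_eq_radial`). Radial test
functions and the du Bois-Reymond lemma make the flux, and then the profile, continuously
differentiable away from the origin (`IsWeakSolution.exists_radial_ode`). A Gronwall argument
upgrades positivity almost everywhere to positivity everywhere (`pos_of_radial_ode`), and
integrability of g^p and |g'|^p near infinity forces g to tend to 0. -/

/-! ### Barriers and unstable linear inequalities on a half line. -/

/-- A differentiable function whose derivative is negative whenever it takes the value `c`
stays below `c`. -/
theorem le_of_hasDerivAt_neg_of_eq {y y' : ℝ → ℝ} {a c : ℝ}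
    (hy : ∀ r ≥ a, HasDerivAt y (y' r) r) (ha : y a ≤ c)
    (h : ∀ r ≥ a, y r = c → y' r < 0) : ∀ r ≥ a, y r ≤ c := by
  intro r hr
  exact image_le_of_deriv_right_lt_deriv_boundary (f := y) (f' := y') (a := a) (b := r)
    (fun x hx => (hy x hx.1).continuousAt.continuousWithinAt)
    (fun x hx => (hy x hx.1).hasDerivWithinAt) (B := fun _ => c) (B' := fun _ => 0) ha
    (fun x => hasDerivAt_const x c) (fun x hx hxc => h x hx.1 hxc) ⟨hr, le_rfl⟩

theorem ge_of_hasDerivAt_pos_of_eq {y y' : ℝ → ℝ} {a c : ℝ}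
    (hy : ∀ r ≥ a, HasDerivAt y (y' r) r) (ha : c ≤ y a)
    (h : ∀ r ≥ a, y r = c → 0 < y' r) : ∀ r ≥ a, c ≤ y r := by
  intro r hr
  have := le_of_hasDerivAt_neg_of_eq (y := fun r => - y r) (y' := fun r => - y' r) (a := a)
    (c := -c) (fun r hr => (hy r hr).neg) (by linarith)
    (fun r hr h1 => by have := h r hr (by linarith); linarith) r hr
  linarith

theorem add_mul_sub_le_of_le_hasDerivAt {y y' : ℝ → ℝ} {a δ : ℝ}
    (hy : ∀ r ≥ a, HasDerivAt y (y' r) r) (h : ∀ r ≥ a, δ ≤ y' r) :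
    ∀ r ≥ a, y a + δ * (r - a) ≤ y r := by
  intro r hr
  have := Convex.mul_sub_le_image_sub_of_le_deriv (convex_Ici a) (f := y)
    (fun x hx => (hy x hx).continuousAt.continuousWithinAt)
    (fun x hx => (hy x (interior_subset hx)).differentiableAt.differentiableWithinAt)
    (C := δ) (fun x hx => by rw [(hy x (interior_subset hx)).deriv]; exact h x (interior_subset hx))
    a Set.self_mem_Ici r hr hr
  linarith

theorem le_add_mul_sub_of_hasDerivAt_le {y y' : ℝ → ℝ} {a δ : ℝ}
    (hy : ∀ r ≥ a, HasDerivAt y (y' r) r) (h : ∀ r ≥ a, y' r ≤ δ) :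
    ∀ r ≥ a, y r ≤ y a + δ * (r - a) := by
  intro r hr
  have := add_mul_sub_le_of_le_hasDerivAt (y := fun r => - y r) (y' := fun r => - y' r) (a := a)
    (δ := -δ) (fun r hr => (hy r hr).neg) (fun r hr => by linarith [h r hr]) r hr
  linarith

/-- A solution of an unstable linear differential inequality that tends to zero is controlled by
the inhomogeneity. -/
theorem le_of_tendsto_zero_of_unstable {y y' B : ℝ → ℝ} {R β γ : ℝ} (hγ : γ < β)
    (hy : ∀ r ≥ R, HasDerivAt y (y' r) r)
    (hy' : ∀ r ≥ R, |y' r - β * y r| ≤ γ * |y r| + B r)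
    (hB : AntitoneOn B (Set.Ici R)) (hB0 : ∀ r ≥ R, 0 ≤ B r)
    (hlim : Tendsto y atTop (𝓝 0)) : ∀ r ≥ R, y r ≤ B r / (β - γ) := by
  intro r₀ hr₀
  by_contra! hlt
  have hβγ : 0 < β - γ := by linarith
  have hpos : 0 < y r₀ := lt_of_le_of_lt (div_nonneg (hB0 r₀ hr₀) hβγ.le) hlt
  -- The level `y r₀` is a barrier: on it the derivative is at least (β - γ) y(r₀) - B(r₀) > 0,
  -- because `B` has not increased since `r₀`.
  have key : ∀ r ≥ r₀, y r₀ ≤ y r := by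
    refine ge_of_hasDerivAt_pos_of_eq (fun r hr => hy r (le_trans hr₀ hr)) le_rfl ?_
    intro r hr hyr
    have hrR : R ≤ r := le_trans hr₀ hr
    have h1 : B r ≤ B r₀ := hB hr₀ hrR hr
    have h2 := (abs_le.1 (hy' r hrR)).1
    rw [hyr, abs_of_pos hpos] at h2
    rw [div_lt_iff₀ hβγ] at hlt
    linarith
  have : y r₀ ≤ 0 := ge_of_tendsto hlim (eventually_atTop.2 ⟨r₀, key⟩)
  linarith

theorem abs_le_of_tendsto_zero_of_unstable {y y' B : ℝ → ℝ} {R β γ : ℝ} (hγ : γ < β)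
    (hy : ∀ r ≥ R, HasDerivAt y (y' r) r)
    (hy' : ∀ r ≥ R, |y' r - β * y r| ≤ γ * |y r| + B r)
    (hB : AntitoneOn B (Set.Ici R)) (hB0 : ∀ r ≥ R, 0 ≤ B r)
    (hlim : Tendsto y atTop (𝓝 0)) : ∀ r ≥ R, |y r| ≤ B r / (β - γ) := by
  intro r hr
  refine abs_le'.2 ⟨le_of_tendsto_zero_of_unstable hγ hy hy' hB hB0 hlim r hr, ?_⟩
  refine le_of_tendsto_zero_of_unstable (y := fun r => - y r) (y' := fun r => - y' r) hγ
    (fun r hr => (hy r hr).fun_neg) (fun r hr => ?_) hB hB0 (by simpa using hlim.neg) r hr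
  have h1 : -y' r - β * -y r = -(y' r - β * y r) := by ring
  simpa only [h1, abs_neg] using hy' r hr

/-! ### Second order Taylor bounds and the Riccati equation. -/

/-- A second derivative at the single point `c` is enough: the derivative of f(x) - f'(c) x is at
most K|x - c| on the ball of radius |x - c| about `c`, and the mean value inequality there supplies
the other factor |x - c|. -/
theorem exists_abs_sub_linear_le {f f' : ℝ → ℝ} {c f'' : ℝ}
    (hf : ∀ᶠ x in 𝓝 c, HasDerivAt f (f' x) x) (hf' : HasDerivAt f' f'' c) :
    ∃ K, 0 ≤ K ∧ ∀ᶠ x in 𝓝 c, |f x - f c - f' c * (x - c)| ≤ K * (x - c) ^ 2 := by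
  obtain ⟨K, hK0, hK⟩ := hf'.isBigO_sub.exists_nonneg
  have hK := hK.bound
  refine ⟨K, hK0, ?_⟩
  obtain ⟨ε, hε, hball⟩ := Metric.eventually_nhds_iff_ball.1 (hf.and hK)
  filter_upwards [Metric.ball_mem_nhds c hε] with x hx
  have hsub : Metric.closedBall c |x - c| ⊆ Metric.ball c ε :=
    Metric.closedBall_subset_ball (by simpa [Real.dist_eq] using hx)
  have := (convex_closedBall c |x - c|).norm_image_sub_le_of_norm_hasDerivWithin_le
    (f := fun x => f x - f' c * x) (f' := fun x => f' x - f' c) (C := K * |x - c|)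
    (fun y hy => by
      have := ((hball y (hsub hy)).1.fun_sub ((hasDerivAt_id y).const_mul (f' c))).hasDerivWithinAt
        (s := Metric.closedBall c |x - c|)
      simpa using this)
    (fun y hy => ((hball y (hsub hy)).2).trans
      (mul_le_mul_of_nonneg_left (by simpa [Real.dist_eq] using hy) hK0))
    (Metric.mem_closedBall_self (abs_nonneg _)) (y := x) (by simp [Real.dist_eq])
  simp only [Real.norm_eq_abs] at this
  rw [mul_assoc, abs_mul_abs_self] at this
  convert this using 2 <;> ring

theorem exists_abs_rpow_sub_linear_le (a : ℝ) {c : ℝ} (hc : 0 < c) :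
    ∃ K, 0 ≤ K ∧
      ∀ᶠ x in 𝓝 c, |x ^ a - c ^ a - a * c ^ (a - 1) * (x - c)| ≤ K * (x - c) ^ 2 := by
  refine exists_abs_sub_linear_le (f := fun x => x ^ a) (f' := fun x => a * x ^ (a - 1)) ?_
    ((Real.hasDerivAt_rpow_const (Or.inl hc.ne')).const_mul a)
  filter_upwards [eventually_gt_nhds hc] with x hx
  exact Real.hasDerivAt_rpow_const (Or.inl hx.ne')

/-- The positive global solutions of the Riccati equation stay eventually above `c - ε`. -/
theorem riccati_eventually_ge {z M : ℝ → ℝ} {α m c k R ε : ℝ} (hα : 0 < α)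
    (hcm : c ^ (1 + α) = α * m) (hk : 0 ≤ k) (hR : 0 < R)
    (hz : ∀ r ≥ R, HasDerivAt z (z r ^ (1 + α) / α - k / r * z r - M r) r)
    (hpos : ∀ r ≥ R, 0 < z r) (hM : Tendsto M atTop (𝓝 m)) (hε : 0 < ε) (hεc : ε < c) :
    ∀ᶠ r in atTop, c - ε ≤ z r := by
  have hlt : (c - ε) ^ (1 + α) < c ^ (1 + α) :=
    Real.rpow_lt_rpow (by linarith) (by linarith) (by linarith)
  -- Half of the gap in (c - ε)^{1+α}/α = m - 2δ absorbs the error M > m - δ; the other half is the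
  -- rate of descent.
  set δ := (c ^ (1 + α) - (c - ε) ^ (1 + α)) / (2 * α) with hδ
  have hδ0 : 0 < δ := by apply div_pos <;> linarith
  obtain ⟨R₁, hR₁⟩ := eventually_atTop.1 (hM.eventually (eventually_gt_nhds (sub_lt_self m hδ0)))
  refine eventually_atTop.2 ⟨max R R₁, fun r₀ hr₀ => ?_⟩
  by_contra! hlt0
  have hder : ∀ r ≥ r₀, z r ≤ c - ε → z r ^ (1 + α) / α - k / r * z r - M r < -δ := by
    intro r hr hzr
    have hrR : R ≤ r := (le_max_left _ _).trans (le_trans hr₀ hr)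
    have hrR₁ : R₁ ≤ r := (le_max_right _ _).trans (le_trans hr₀ hr)
    have h1 : z r ^ (1 + α) ≤ (c - ε) ^ (1 + α) :=
      Real.rpow_le_rpow (hpos r hrR).le hzr (by linarith)
    have h2 : z r ^ (1 + α) / α ≤ (c - ε) ^ (1 + α) / α := by gcongr
    have h3 : 0 ≤ k / r * z r :=
      mul_nonneg (div_nonneg hk (by linarith)) (hpos r hrR).le
    have h4 := hR₁ r hrR₁
    have h5 : (c - ε) ^ (1 + α) / α = m - 2 * δ := by
      rw [hδ, hcm]; field_simp; ring
    linarith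
  have hr₀R : R ≤ r₀ := (le_max_left _ _).trans hr₀
  have htrap : ∀ r ≥ r₀, z r ≤ c - ε := by
    refine le_of_hasDerivAt_neg_of_eq (fun r hr => hz r (hr₀R.trans hr)) hlt0.le ?_
    intro r hr hzr
    linarith [hder r hr hzr.le]
  have hdecay := le_add_mul_sub_of_hasDerivAt_le (fun r hr => hz r (hr₀R.trans hr))
    (fun r hr => (hder r hr (htrap r hr)).le)
  have hz0 := hpos r₀ hr₀R
  -- At this radius the linear upper bound for `z` reaches zero.
  have h1 : r₀ ≤ r₀ + z r₀ / δ := by have := div_pos hz0 hδ0; linarith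
  have h2 := hdecay _ h1
  have h3 := hpos _ (hr₀R.trans h1)
  have h4 : z r₀ + -δ * (r₀ + z r₀ / δ - r₀) = 0 := by field_simp; ring
  linarith

/-- The positive global solutions of the Riccati equation stay eventually below `c + ε`. -/
theorem riccati_eventually_le {z M : ℝ → ℝ} {α m c k R ε : ℝ} (hα : 0 < α) (hc : 0 < c)
    (hcm : c ^ (1 + α) = α * m)
    (hz : ∀ r ≥ R, HasDerivAt z (z r ^ (1 + α) / α - k / r * z r - M r) r)
    (hpos : ∀ r ≥ R, 0 < z r) (hM : Tendsto M atTop (𝓝 m)) (hε : 0 < ε) :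
    ∀ᶠ r in atTop, z r ≤ c + ε := by
  set Z₀ := c ^ (1 + α) with hZ₀
  set Z₁ := (c + ε) ^ (1 + α) with hZ₁
  have hZ₀0 : 0 < Z₀ := by positivity
  have hlt : Z₀ < Z₁ := Real.rpow_lt_rpow hc.le (by linarith) (by linarith)
  -- Chosen so that 1/α - 3δ = (Z₀/Z₁)/α. Above c + ε, three shares δ z^{1+α} pay for the drift k/r,
  -- for the excess of M over m, and for the growth that is kept.
  set δ := (1 - Z₀ / Z₁) / (3 * α) with hδ
  have hδ0 : 0 < δ := by
    apply div_pos _ (by linarith)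
    have : Z₀ / Z₁ < 1 := (div_lt_one (by linarith)).2 hlt
    linarith
  have hkr : Tendsto (fun r : ℝ => k / r) atTop (𝓝 0) := tendsto_const_nhds.div_atTop tendsto_id
  have hE : ∀ᶠ r in atTop, M r < m + δ * Z₀ ∧ k / r < δ * c ^ α :=
    (hM.eventually (eventually_lt_nhds (lt_add_of_pos_right m (by positivity)))).and
      (hkr.eventually (eventually_lt_nhds (by positivity)))
  obtain ⟨R₁, hR₁⟩ := eventually_atTop.1 hE
  refine eventually_atTop.2 ⟨max R R₁, fun r₀ hr₀ => ?_⟩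
  by_contra! hlt0
  have hr₀R : R ≤ r₀ := (le_max_left _ _).trans hr₀
  have hder : ∀ r ≥ r₀, c + ε ≤ z r →
      δ * z r ^ (1 + α) ≤ z r ^ (1 + α) / α - k / r * z r - M r := by
    intro r hr hzr
    have hrR₁ : R₁ ≤ r := (le_max_right _ _).trans (le_trans hr₀ hr)
    obtain ⟨h1, h2⟩ := hR₁ r hrR₁
    have hzp : 0 < z r := by linarith
    have hZ : Z₁ ≤ z r ^ (1 + α) := Real.rpow_le_rpow (by linarith) hzr (by linarith)
    set Z := z r ^ (1 + α) with hZdef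
    have h3 : c ^ α * z r ≤ Z := by
      rw [hZdef, Real.rpow_add hzp, Real.rpow_one, mul_comm]
      gcongr; linarith
    have h4 : k / r * z r ≤ δ * Z := by
      calc k / r * z r ≤ (δ * c ^ α) * z r := by gcongr
        _ = δ * (c ^ α * z r) := by ring
        _ ≤ δ * Z := by gcongr
    have h5 : δ * Z₀ ≤ δ * Z := by gcongr; linarith
    have h6 : m ≤ Z * (1 / α - 3 * δ) := by
      have : 1 / α - 3 * δ = Z₀ / Z₁ / α := by rw [hδ]; field_simp; ring
      rw [this]
      have hm : m = Z₀ / α := by rw [hcm]; field_simp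
      calc m = Z₁ * (Z₀ / Z₁ / α) := by
            rw [hm]; have : Z₁ ≠ 0 := by linarith
            field_simp
        _ ≤ Z * (Z₀ / Z₁ / α) := by gcongr
    have h7 : Z * (1 / α - 3 * δ) = Z / α - 3 * (δ * Z) := by ring
    linarith
  have htrap : ∀ r ≥ r₀, c + ε ≤ z r := by
    refine ge_of_hasDerivAt_pos_of_eq (fun r hr => hz r (hr₀R.trans hr)) hlt0.le ?_
    intro r hr hzr
    have := hder r hr hzr.ge
    have h0 := hpos r (hr₀R.trans hr)
    exact lt_of_lt_of_le (by positivity) this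
  -- Superlinear growth means blow-up at finite radius: z' ≥ δ z^{1+α} makes the positive quantity
  -- z^{-α} decrease at rate at least αδ, so it would reach zero.
  have hy : ∀ r ≥ r₀, HasDerivAt (fun r => z r ^ (-α))
      ((z r ^ (1 + α) / α - k / r * z r - M r) * (-α) * z r ^ (-α - 1)) r := fun r hr =>
    (hz r (hr₀R.trans hr)).rpow_const (Or.inl (hpos r (hr₀R.trans hr)).ne')
  have hdecay := le_add_mul_sub_of_hasDerivAt_le (δ := -(α * δ)) hy (fun r hr => by
    have h0 := hpos r (hr₀R.trans hr)
    have h1 := hder r hr (htrap r hr)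
    have h2 : z r ^ (1 + α) * z r ^ (-α - 1) = 1 := by
      rw [← Real.rpow_add h0, show 1 + α + (-α - 1) = 0 by ring, Real.rpow_zero]
    have h3 := mul_le_mul_of_nonneg_right h1 (by positivity : 0 ≤ α * z r ^ (-α - 1))
    have h4 : δ * z r ^ (1 + α) * (α * z r ^ (-α - 1)) = α * δ := by
      linear_combination (α * δ) * h2
    linarith)
  have hz0 := hpos r₀ hr₀R
  have hz1 : 0 < z r₀ ^ (-α) := by positivity
  have h1 : r₀ ≤ r₀ + z r₀ ^ (-α) / (α * δ) := by
    have : 0 < z r₀ ^ (-α) / (α * δ) := by positivity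
    linarith
  have h2 := hdecay _ h1
  have h3 := hpos _ (hr₀R.trans h1)
  have h4 : z r₀ ^ (-α) + -(α * δ) * (r₀ + z r₀ ^ (-α) / (α * δ) - r₀) = 0 := by
    field_simp; ring
  have h5 := Real.rpow_pos_of_pos h3 (-α)
  linarith

theorem riccati_tendsto {z M : ℝ → ℝ} {α m c k R : ℝ} (hα : 0 < α) (hc : 0 < c)
    (hcm : c ^ (1 + α) = α * m) (hk : 0 ≤ k) (hR : 0 < R)
    (hz : ∀ r ≥ R, HasDerivAt z (z r ^ (1 + α) / α - k / r * z r - M r) r)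
    (hpos : ∀ r ≥ R, 0 < z r) (hM : Tendsto M atTop (𝓝 m)) :
    Tendsto z atTop (𝓝 c) := by
  rw [Metric.tendsto_nhds]
  intro ε hε
  have hε' : 0 < min (ε / 2) (c / 2) := by positivity
  filter_upwards [riccati_eventually_ge hα hcm hk hR hz hpos hM hε'
    ((min_le_right _ _).trans_lt (by linarith)),
    riccati_eventually_le hα hc hcm hz hpos hM hε'] with r h1 h2
  have := min_le_left (ε / 2) (c / 2)
  rw [Real.dist_eq, abs_lt]
  constructor <;> linarith

/-- Linearise at `c`: the remainder y = z - c - d/r satisfies y' = βy plus terms that are small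
multiples of y or O(r^{-s}), with β > 0. The condition on `d` cancels the terms of order 1/r. Since
y tends to zero along an unstable equation, it is dominated by the inhomogeneity. The bound s ≤ 2
lets the r^{-2} terms be absorbed. -/
theorem riccati_expansion {z M : ℝ → ℝ} {α m c k d R s E : ℝ} (hα : 0 < α) (hc : 0 < c)
    (hcm : c ^ (1 + α) = α * m) (hd : d * ((1 + α) * c ^ α) = k * c * α)
    (hz : ∀ r ≥ R, HasDerivAt z (z r ^ (1 + α) / α - k / r * z r - M r) r)
    (hzc : Tendsto z atTop (𝓝 c)) (hs0 : 0 ≤ s) (hs : s ≤ 2)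
    (hM : ∀ᶠ r in atTop, |M r - m| ≤ E * r ^ (-s)) :
    ∃ K, ∀ᶠ r in atTop, |z r - c - d / r| ≤ K * r ^ (-s) := by
  obtain ⟨K, hK0, hK⟩ := exists_abs_rpow_sub_linear_le (1 + α) hc
  have hK := hzc.eventually hK
  have hdr : Tendsto (fun r : ℝ => d / r) atTop (𝓝 0) := tendsto_const_nhds.div_atTop tendsto_id
  have hkr : Tendsto (fun r : ℝ => k / r) atTop (𝓝 0) := tendsto_const_nhds.div_atTop tendsto_id
  set β := (1 + α) * c ^ α / α with hβ
  have hβ0 : 0 < β := by positivity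
  have hylim : Tendsto (fun r => z r - c - d / r) atTop (𝓝 0) := by
    simpa using (hzc.sub_const c).sub hdr
  -- The quadratic error and the drift k/r each take a quarter of β, leaving γ = β/2 in the unstable
  -- inequality.
  have hysm : ∀ᶠ r in atTop, 2 * (K / α) * |z r - c - d / r| ≤ β / 4 := by
    have := (hylim.abs.const_mul (2 * (K / α)))
    simp only [abs_zero, mul_zero] at this
    exact this.eventually (eventually_le_nhds (by positivity))
  have hksm : ∀ᶠ r in atTop, |k / r| ≤ β / 4 := by
    have := hkr.abs
    simp only [abs_zero] at this
    exact this.eventually (eventually_le_nhds (by positivity))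
  obtain ⟨R₁, hR₁⟩ := eventually_atTop.1 (hK.and (hM.and (hysm.and (hksm.and
    ((eventually_ge_atTop R).and (eventually_ge_atTop 1))))))
  have hE0 : 0 ≤ E := by
    obtain ⟨-, h1, -, -, -, h2⟩ := hR₁ R₁ le_rfl
    have h3 : 0 < R₁ ^ (-s) := Real.rpow_pos_of_pos (by linarith) _
    by_contra! hneg
    nlinarith [abs_nonneg (M R₁ - m)]
  set D := 2 * (K / α) * d ^ 2 + |d - k * d| + E with hD
  have hD0 : 0 ≤ D := by positivity
  refine ⟨D / (β - β / 2), eventually_atTop.2 ⟨R₁, fun r hr => ?_⟩⟩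
  have main := abs_le_of_tendsto_zero_of_unstable (y := fun r => z r - c - d / r)
    (y' := fun r => (z r ^ (1 + α) / α - k / r * z r - M r) - (-d / r ^ 2))
    (B := fun r => D * r ^ (-s)) (R := R₁) (β := β) (γ := β / 2) (by linarith)
    ?_ ?_ ?_ ?_ hylim r hr
  · rw [div_mul_eq_mul_div]; exact main
  · intro r hr
    obtain ⟨-, -, -, -, h1, h2⟩ := hR₁ r hr
    have hr0 : r ≠ 0 := by linarith
    have h3 : HasDerivAt (fun r => d / r) (-d / r ^ 2) r := by
      simpa using (hasDerivAt_const r d).fun_div (hasDerivAt_id r) hr0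
    exact ((hz r h1).sub_const c).fun_sub h3
  · intro r hr
    obtain ⟨h1, h2, h3, h4, -, h5⟩ := hR₁ r hr
    have hr0 : r ≠ 0 := by linarith
    have hrp : 0 < r := by linarith
    set y := z r - c - d / r with hy
    have hzy : z r = c + (y + d / r) := by rw [hy]; ring
    set Q := (z r ^ (1 + α) - c ^ (1 + α) - (1 + α) * c ^ (1 + α - 1) * (z r - c)) / α with hQ
    have hQb : |Q| ≤ K / α * (y + d / r) ^ 2 := by
      rw [hQ, abs_div, abs_of_pos hα, div_mul_eq_mul_div]
      have : z r - c = y + d / r := by rw [hzy]; ring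
      rw [← this]; gcongr
    have hid : (z r ^ (1 + α) / α - k / r * z r - M r) - (-d / r ^ 2) - β * y
        = Q - k / r * y + ((d - k * d) / r ^ 2 - (M r - m)) := by
      have e1 : z r ^ (1 + α) / α = Q + m + β * (y + d / r) := by
        rw [hQ, hcm, hβ, hzy, show 1 + α - 1 = α by ring]; field_simp; ring
      have e2 : β * (d / r) = k / r * c := by
        have : d * ((1 + α) * c ^ α) = k * c * α := hd
        rw [hβ]; field_simp; linarith
      have e3 : k / r * z r = k / r * c + k / r * y + k * d / r ^ 2 := by
        rw [hzy]; field_simp; ring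
      rw [e1, e3, mul_add, e2]; ring
    rw [hid]
    have hr2 : 1 / r ^ 2 ≤ r ^ (-s) := by
      rw [one_div, ← Real.rpow_natCast, ← Real.rpow_neg hrp.le]
      exact Real.rpow_le_rpow_of_exponent_le h5 (by push_cast; linarith)
    have hQ2 : |Q| ≤ β / 4 * |y| + 2 * (K / α) * d ^ 2 * r ^ (-s) := by
      have g1 : (y + d / r) ^ 2 ≤ 2 * |y| * |y| + 2 * (d ^ 2 * (1 / r ^ 2)) := by
        rw [mul_assoc, abs_mul_abs_self]
        have : d ^ 2 * (1 / r ^ 2) = (d / r) ^ 2 := by field_simp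
        rw [this]; nlinarith [sq_nonneg (y - d / r)]
      calc |Q| ≤ K / α * (y + d / r) ^ 2 := hQb
        _ ≤ K / α * (2 * |y| * |y| + 2 * (d ^ 2 * r ^ (-s))) := by
            gcongr; exact g1.trans (by gcongr)
        _ = (2 * (K / α) * |y|) * |y| + 2 * (K / α) * d ^ 2 * r ^ (-s) := by ring
        _ ≤ _ := by gcongr
    have hk2 : |k / r * y| ≤ β / 4 * |y| := by rw [abs_mul]; gcongr
    have hd2 : |(d - k * d) / r ^ 2| ≤ |d - k * d| * r ^ (-s) := by
      rw [abs_div, abs_of_pos (by positivity : 0 < r ^ 2), div_eq_mul_one_div]; gcongr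
    calc |Q - k / r * y + ((d - k * d) / r ^ 2 - (M r - m))|
        ≤ (|Q| + |k / r * y|) + (|(d - k * d) / r ^ 2| + |M r - m|) :=
          (abs_add_le _ _).trans (add_le_add (abs_sub _ _) (abs_sub _ _))
      _ ≤ _ := by rw [hD]; linarith
  · intro a ha b hb hab
    obtain ⟨-, -, -, -, -, h5⟩ := hR₁ a ha
    simp only
    gcongr D * ?_
    exact Real.rpow_le_rpow_of_nonpos (by linarith) hab (by linarith)
  · intro a ha
    obtain ⟨-, -, -, -, -, h5⟩ := hR₁ a ha
    have : 0 < a := by linarith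
    positivity

/-! ### From the Riccati variable back to the profile. -/

/-- Integration of a logarithmic derivative with an integrable remainder. -/
theorem tendsto_mul_rpow_mul_exp_of_logDeriv {g h : ℝ → ℝ} {lam b R K s : ℝ}
    (hR : 0 < R) (hg : ∀ r ≥ R, HasDerivAt g (-(h r) * g r) r) (hpos : ∀ r ≥ R, 0 < g r)
    (hh : ContinuousOn h (Set.Ici R)) (hs : 1 < s)
    (hb : ∀ r ≥ R, |h r - lam - b / r| ≤ K * r ^ (-s)) :
    ∃ C, 0 < C ∧
      Tendsto (fun r => g r * r ^ b * Real.exp (lam * r)) atTop (𝓝 C) := by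
  have hder : ∀ r ∈ Set.Ioi R,
      HasDerivAt (fun r => Real.log (g r) + b * Real.log r + lam * r) (-(h r - lam - b / r)) r := by
    intro r hr
    have hr' : R ≤ r := le_of_lt hr
    have h1 := (hg r hr').log (hpos r hr').ne'
    have h2 := (Real.hasDerivAt_log (by linarith : r ≠ 0)).const_mul b
    have h3 := (hasDerivAt_id r).const_mul lam
    have h4 := (hpos r hr').ne'
    have hr0 : r ≠ 0 := by linarith
    exact ((h1.fun_add h2).fun_add h3).congr_deriv (by field_simp; ring)
  have hint : IntegrableOn (fun r => -(h r - lam - b / r)) (Set.Ioi R) := by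
    refine Integrable.mono' ((integrableOn_Ioi_rpow_of_lt (by linarith : -s < -1) hR).const_mul K)
      ?_ ?_
    · refine ContinuousOn.aestronglyMeasurable ?_ measurableSet_Ioi
      refine (((hh.mono Set.Ioi_subset_Ici_self).sub continuousOn_const).sub ?_).neg
      exact continuousOn_const.div continuousOn_id fun x hx => (hR.trans hx).ne'
    · filter_upwards [ae_restrict_mem measurableSet_Ioi] with r hr
      rw [norm_neg]
      exact hb r (le_of_lt hr)
  have hlim := tendsto_limUnder_of_hasDerivAt_of_integrableOn_Ioi hder hint
  refine ⟨_, Real.exp_pos _, ((Real.continuous_exp.tendsto _).comp hlim).congr' ?_⟩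
  filter_upwards [eventually_ge_atTop R] with r hr
  have hr0 : 0 < r := by linarith
  simp only [Function.comp]
  rw [Real.exp_add, Real.exp_add, Real.exp_log (hpos r hr), Real.rpow_def_of_pos hr0, mul_comm b]

/-- Here -g'/g = z^α. Taylor expansion at `c` turns the d/r term of z into α c^{α-1} d/r, which
gives the power of r; the square of z - c is O(r^{-2}), so the whole remainder is O(r^{-s}),
integrable as s > 1. -/
theorem tendsto_of_riccati {g z M : ℝ → ℝ} {α m c k d R s E : ℝ} (hα : 0 < α) (hc : 0 < c)
    (hcm : c ^ (1 + α) = α * m) (hd : d * ((1 + α) * c ^ α) = k * c * α)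
    (hz : ∀ r ≥ R, HasDerivAt z (z r ^ (1 + α) / α - k / r * z r - M r) r)
    (hzc : Tendsto z atTop (𝓝 c)) (hs1 : 1 < s) (hs : s ≤ 2)
    (hM : ∀ᶠ r in atTop, |M r - m| ≤ E * r ^ (-s))
    (hg : ∀ r ≥ R, HasDerivAt g (-(z r ^ α) * g r) r) (hpos : ∀ r ≥ R, 0 < g r) :
    ∃ C, 0 < C ∧ Tendsto (fun r => g r * r ^ (α * c ^ (α - 1) * d) * Real.exp (c ^ α * r))
      atTop (𝓝 C) := by
  obtain ⟨K₁, hK₁⟩ := riccati_expansion hα hc hcm hd hz hzc (by linarith) hs hM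
  obtain ⟨K, hK0, hK⟩ := exists_abs_rpow_sub_linear_le α hc
  have hK := hzc.eventually hK
  obtain ⟨R₁, hR₁⟩ := eventually_atTop.1 (hK₁.and (hK.and
    ((eventually_ge_atTop R).and (eventually_ge_atTop 1))))
  have hR₁1 := (hR₁ R₁ le_rfl).2.2.2
  have hR₁R := (hR₁ R₁ le_rfl).2.2.1
  refine tendsto_mul_rpow_mul_exp_of_logDeriv (R := R₁) (h := fun r => z r ^ α) (s := s)
    (K := K * (2 * K₁ ^ 2 + 2 * d ^ 2) + α * c ^ (α - 1) * K₁) (by linarith)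
    (fun r hr => hg r (hR₁R.trans hr)) (fun r hr => hpos r (hR₁R.trans hr)) ?_ hs1 ?_
  · intro r hr
    exact ((hz r (hR₁R.trans hr)).continuousAt.rpow_const (Or.inr hα.le)).continuousWithinAt
  · intro r hr
    obtain ⟨h1, h2, -, h3⟩ := hR₁ r hr
    have hrp : 0 < r := by linarith
    set y := z r - c - d / r with hy
    set t := r ^ (-s) with ht
    have ht0 : 0 < t := Real.rpow_pos_of_pos hrp _
    have ht1 : t ≤ 1 := Real.rpow_le_one_of_one_le_of_nonpos h3 (by linarith)
    have hr2 : 1 / r ^ 2 ≤ t := by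
      rw [one_div, ← Real.rpow_natCast, ← Real.rpow_neg hrp.le]
      exact Real.rpow_le_rpow_of_exponent_le h3 (by push_cast; linarith)
    have hzc2 : (z r - c) ^ 2 ≤ (2 * K₁ ^ 2 + 2 * d ^ 2) * t := by
      have e1 : z r - c = y + d / r := by rw [hy]; ring
      have e2 : y ^ 2 ≤ K₁ ^ 2 * t := by
        calc y ^ 2 = |y| ^ 2 := (sq_abs y).symm
          _ ≤ (K₁ * t) ^ 2 := by gcongr
          _ = K₁ ^ 2 * (t * t) := by ring
          _ ≤ K₁ ^ 2 * (t * 1) := by gcongr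
          _ = _ := by ring
      have e3 : (d / r) ^ 2 ≤ d ^ 2 * t := by
        rw [div_pow, div_eq_mul_one_div]; gcongr
      rw [e1]
      nlinarith [sq_nonneg (y - d / r)]
    have hid : z r ^ α - c ^ α - α * c ^ (α - 1) * d / r
        = (z r ^ α - c ^ α - α * c ^ (α - 1) * (z r - c)) + α * c ^ (α - 1) * y := by
      rw [hy]; ring
    rw [hid]
    calc _ ≤ |z r ^ α - c ^ α - α * c ^ (α - 1) * (z r - c)| + |α * c ^ (α - 1) * y| :=
          abs_add_le _ _
      _ ≤ K * (z r - c) ^ 2 + α * c ^ (α - 1) * |y| := by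
          rw [abs_mul, abs_of_pos (by positivity : 0 < α * c ^ (α - 1))]; gcongr
      _ ≤ K * ((2 * K₁ ^ 2 + 2 * d ^ 2) * t) + α * c ^ (α - 1) * (K₁ * t) := by gcongr
      _ = _ := by ring

/-- A crude exponential rate, needed before the precise one: it makes the nonlinear part of the
Riccati coefficient negligible. -/
theorem eventually_le_exp_of_logDeriv {g h : ℝ → ℝ} {κ R : ℝ}
    (hg : ∀ r ≥ R, HasDerivAt g (-(h r) * g r) r) (hpos : ∀ r ≥ R, 0 < g r)
    (hh : ∀ r ≥ R, κ ≤ h r) :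
    ∀ r ≥ R, g r ≤ (g R * Real.exp (κ * R)) * Real.exp (-κ * r) := by
  intro r hr
  have hder : ∀ r ≥ R, HasDerivAt (fun r => Real.log (g r)) (-(h r)) r := fun r hr =>
    ((hg r hr).log (hpos r hr).ne').congr_deriv (by have := (hpos r hr).ne'; field_simp)
  have h1 := le_add_mul_sub_of_hasDerivAt_le (δ := -κ) hder (fun r hr => neg_le_neg (hh r hr)) r hr
  have h2 := Real.exp_le_exp.2 h1
  rw [Real.exp_log (hpos r hr), Real.exp_add, Real.exp_log (hpos R le_rfl)] at h2
  refine h2.trans (le_of_eq ?_)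
  rw [mul_assoc, ← Real.exp_add]; congr 2; ring

/-- At a zero of `w` its derivative is M G > 0, so once nonnegative `w` stays so. Then `g` is
nondecreasing and positive and cannot tend to zero. The sign of `w` is what makes the Riccati
variable positive. -/
theorem negative_of_radial_ode {α k R : ℝ} {g w M G : ℝ → ℝ}
    (hg : ∀ r ≥ R, HasDerivAt g (|w r| ^ (α - 1) * w r) r)
    (hw : ∀ r ≥ R, HasDerivAt w (-(k / r) * w r + M r * G r) r)
    (hpos : ∀ r ≥ R, 0 < g r) (hlim : Tendsto g atTop (𝓝 0))
    (hM : ∀ r ≥ R, 0 < M r) (hG : ∀ r ≥ R, 0 < G r) : ∀ r ≥ R, w r < 0 := by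
  intro r₀ hr₀
  by_contra! h0
  have hw0 : ∀ r ≥ r₀, 0 ≤ w r := by
    refine ge_of_hasDerivAt_pos_of_eq (fun r hr => hw r (le_trans hr₀ hr)) h0 fun r hr h => ?_
    have := mul_pos (hM r (le_trans hr₀ hr)) (hG r (le_trans hr₀ hr))
    simpa [h] using this
  have hg0 := add_mul_sub_le_of_le_hasDerivAt (δ := 0) (fun r hr => hg r (le_trans hr₀ hr))
    (fun r hr => mul_nonneg (by positivity) (hw0 r hr))
  have : g r₀ ≤ 0 :=
    ge_of_tendsto hlim (eventually_atTop.2 ⟨r₀, fun r hr => by simpa using hg0 r hr⟩)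
  exact absurd (hpos r₀ hr₀) (by linarith)

/-- The substitution z = -w g^{1-p} removes the homogeneity of degree p - 1 and yields the Riccati
equation, first with M → m only; the resulting exponential decay of `g` then improves this to a
rate, as the expansion requires. -/
theorem tendsto_of_radial_ode {k p μ m q A : ℝ} {f g w : ℝ → ℝ} (hp : 1 < p) (hk : 0 ≤ k)
    (hm : 0 < m) (hq : p < q)
    (hf : ∀ᶠ t in 𝓝[>] 0, |f t| ≤ A * t ^ (q - 1))
    (hg : ∀ r > 0, HasDerivAt g (|w r| ^ (1 / (p - 1) - 1) * w r) r)
    (hw : ∀ r > 0, HasDerivAt w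
      (-(k / r) * w r + ((m - μ / r ^ p) * g r ^ (p - 1) - f (g r))) r)
    (hpos : ∀ r > 0, 0 < g r) (hlim : Tendsto g atTop (𝓝 0)) :
    ∃ C, 0 < C ∧ Tendsto (fun r => g r * r ^ (k / (p * (p - 1))) *
      Real.exp ((m / (p - 1)) ^ (1 / p) * r)) atTop (𝓝 C) := by
  have hp1 : 0 < p - 1 := by linarith
  set α := 1 / (p - 1) with hα
  have hα0 : 0 < α := by positivity
  have hpα : p - 1 = 1 / α := by rw [hα]; field_simp
  set c := (α * m) ^ (1 / (1 + α)) with hc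
  have hc0 : 0 < c := by positivity
  have hcm : c ^ (1 + α) = α * m := by
    rw [hc, ← Real.rpow_mul (by positivity), one_div_mul_cancel (by positivity), Real.rpow_one]
  have hcα : c ^ α = (m / (p - 1)) ^ (1 / p) := by
    rw [hc, ← Real.rpow_mul (by positivity)]
    congr 1
    · rw [hα]; ring
    · rw [hα]; field_simp; ring
  set M : ℝ → ℝ := fun r => m - μ / r ^ p - f (g r) * g r ^ (1 - p) with hMdef
  have hgpos : ∀ᶠ r in atTop, 0 < g r := (eventually_gt_atTop 0).mono hpos
  have hfM : ∀ᶠ r in atTop, |f (g r) * g r ^ (1 - p)| ≤ A * g r ^ (q - p) := by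
    have hlim' : Tendsto g atTop (𝓝[>] 0) := tendsto_nhdsWithin_iff.2 ⟨hlim, hgpos⟩
    filter_upwards [hlim'.eventually hf, hgpos] with r h1 h2
    have h3 := Real.rpow_pos_of_pos h2 (1 - p)
    rw [abs_mul, abs_of_pos h3]
    calc |f (g r)| * g r ^ (1 - p) ≤ (A * g r ^ (q - 1)) * g r ^ (1 - p) := by gcongr
      _ = A * g r ^ (q - p) := by
        rw [mul_assoc, ← Real.rpow_add h2]; congr 2; ring
  have hMlim : Tendsto M atTop (𝓝 m) := by
    have h1 : Tendsto (fun r : ℝ => μ / r ^ p) atTop (𝓝 0) :=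
      tendsto_const_nhds.div_atTop (tendsto_rpow_atTop (by linarith))
    have h2 : Tendsto (fun r => A * g r ^ (q - p)) atTop (𝓝 0) := by
      have := (hlim.rpow_const (p := q - p) (Or.inr (by linarith))).const_mul A
      rwa [Real.zero_rpow (by linarith), mul_zero] at this
    have h3 : Tendsto (fun r => f (g r) * g r ^ (1 - p)) atTop (𝓝 0) :=
      squeeze_zero_norm' hfM h2
    simpa using (h1.const_sub m).sub h3
  obtain ⟨R, hR⟩ := eventually_atTop.1
    ((hMlim.eventually (eventually_gt_nhds hm)).and (eventually_ge_atTop 1))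
  have hRp : ∀ r ≥ R, 0 < r := fun r hr => by have := (hR r hr).2; linarith
  have hw' : ∀ r > 0, HasDerivAt w (-(k / r) * w r + M r * g r ^ (p - 1)) r := by
    intro r hr
    refine (hw r hr).congr_deriv ?_
    have h1 : g r ^ (1 - p) * g r ^ (p - 1) = 1 := by
      rw [← Real.rpow_add (hpos r hr), show 1 - p + (p - 1) = 0 by ring, Real.rpow_zero]
    simp only [hMdef]
    linear_combination (f (g r)) * h1
  have hwneg : ∀ r ≥ R, w r < 0 := negative_of_radial_ode (fun r hr => hg r (hRp r hr))
    (fun r hr => hw' r (hRp r hr)) (fun r hr => hpos r (hRp r hr)) hlim (fun r hr => (hR r hr).1)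
    (fun r hr => Real.rpow_pos_of_pos (hpos r (hRp r hr)) _)
  set z : ℝ → ℝ := fun r => -w r * g r ^ (1 - p) with hzdef
  have hzpos : ∀ r ≥ R, 0 < z r := fun r hr =>
    mul_pos (neg_pos.2 (hwneg r hr)) (Real.rpow_pos_of_pos (hpos r (hRp r hr)) _)
  have hgz : ∀ r ≥ R, HasDerivAt g (-(z r ^ α) * g r) r := by
    intro r hr
    have hgr := hpos r (hRp r hr)
    have hwr := hwneg r hr
    refine (hg r (hRp r hr)).congr_deriv ?_
    have h1 : z r ^ α * g r = (-w r) ^ α := by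
      simp only [hzdef]
      rw [Real.mul_rpow (by linarith) (by positivity), ← Real.rpow_mul hgr.le,
        show (1 - p) * α = -1 by rw [hα]; field_simp; ring, Real.rpow_neg_one, mul_assoc,
        inv_mul_cancel₀ hgr.ne', mul_one]
    have h2 : |w r| ^ (α - 1) * -w r = (-w r) ^ α := by
      rw [abs_of_neg hwr, Real.rpow_sub_one (by linarith), div_mul_cancel₀ _ (by linarith)]
    rw [neg_mul, h1, ← h2]; ring
  have hz : ∀ r ≥ R, HasDerivAt z (z r ^ (1 + α) / α - k / r * z r - M r) r := by
    intro r hr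
    have hgr := hpos r (hRp r hr)
    have h1 := (hw' r (hRp r hr)).fun_neg.fun_mul
      ((hgz r hr).rpow_const (p := 1 - p) (Or.inl hgr.ne'))
    refine h1.congr_deriv ?_
    have h2 : g r ^ (p - 1) * g r ^ (1 - p) = 1 := by
      rw [← Real.rpow_add hgr, show p - 1 + (1 - p) = 0 by ring, Real.rpow_zero]
    have h3 : g r * g r ^ (1 - p - 1) = g r ^ (1 - p) := by
      rw [Real.rpow_sub_one hgr.ne']; field_simp
    have h4 : z r ^ (1 + α) = z r * z r ^ α := by
      rw [Real.rpow_add (hzpos r hr), Real.rpow_one]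
    have h5 : z r ^ (1 + α) / α = (p - 1) * (z r ^ α * (-w r * g r ^ (1 - p))) := by
      rw [h4, hpα]; simp only [hzdef]; field_simp
    rw [h5]
    have h6 : z r = -w r * g r ^ (1 - p) := rfl
    linear_combination (-M r) * h2 + (w r * z r ^ α * (1 - p)) * h3 + (-(k / r)) * h6
  have hR0 : 0 < R := hRp R le_rfl
  have hzc := riccati_tendsto hα0 hc0 hcm hk hR0 hz hzpos hMlim
  set lam := c ^ α with hlam
  have hlam0 : 0 < lam := by positivity
  -- Half of the true decay rate suffices: g^{q-p} is then exponentially small, hence below r^{-s}.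
  obtain ⟨R₂, hR₂⟩ := eventually_atTop.1 (((hzc.rpow_const (p := α) (Or.inr hα0.le)).eventually
    (eventually_ge_nhds (half_lt_self hlam0))).and (eventually_ge_atTop R))
  have hexp := eventually_le_exp_of_logDeriv (κ := lam / 2) (h := fun r => z r ^ α) (R := R₂)
    (fun r hr => hgz r (hR₂ r hr).2) (fun r hr => hpos r (hRp r (hR₂ r hr).2))
    (fun r hr => (hR₂ r hr).1)
  set D := g R₂ * Real.exp (lam / 2 * R₂) with hD
  have hD0 : 0 < D := mul_pos (hpos _ (hRp _ (hR₂ _ le_rfl).2)) (Real.exp_pos _)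
  -- The exponent `p` comes from the Hardy term μ/r^p, and 2 from the expansion; s > 1 because p >
  -- 1.
  set s := min p 2 with hs
  have hE : ∀ᶠ r in atTop, |M r - m| ≤ (|μ| + |A| * D ^ (q - p)) * r ^ (-s) := by
    have hlo := (isLittleO_exp_neg_mul_rpow_atTop (a := lam / 2 * (q - p))
      (by have : 0 < q - p := by linarith
          positivity) (-s)).bound one_pos
    filter_upwards [hfM, hlo, eventually_ge_atTop R₂] with r h1 h2 h3
    have hrp := hRp r ((hR₂ r h3).2)
    have hr1 := (hR r ((hR₂ r h3).2)).2
    have hgr := hpos r hrp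
    rw [one_mul, Real.norm_eq_abs, Real.norm_eq_abs, abs_of_pos (Real.exp_pos _),
      abs_of_pos (Real.rpow_pos_of_pos hrp _)] at h2
    have h4 : g r ^ (q - p) ≤ D ^ (q - p) * r ^ (-s) := by
      calc g r ^ (q - p) ≤ (D * Real.exp (-(lam / 2) * r)) ^ (q - p) :=
            Real.rpow_le_rpow hgr.le (hexp r h3) (by linarith)
        _ = D ^ (q - p) * Real.exp (-(lam / 2 * (q - p)) * r) := by
            rw [Real.mul_rpow hD0.le (Real.exp_pos _).le, ← Real.exp_mul]; congr 2; ring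
        _ ≤ _ := by gcongr
    have h5 : |μ / r ^ p| ≤ |μ| * r ^ (-s) := by
      rw [abs_div, abs_of_pos (Real.rpow_pos_of_pos hrp p), div_eq_mul_inv,
        ← Real.rpow_neg hrp.le]
      gcongr
      exact min_le_left _ _
    have h6 : A * g r ^ (q - p) ≤ |A| * (D ^ (q - p) * r ^ (-s)) := by
      have h7 := Real.rpow_nonneg hgr.le (q - p)
      gcongr; exact le_abs_self A
    calc |M r - m| = |-(μ / r ^ p) - f (g r) * g r ^ (1 - p)| := by
          simp only [hMdef]; congr 1; ring
      _ ≤ |μ / r ^ p| + |f (g r) * g r ^ (1 - p)| := by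
          rw [← abs_neg (μ / r ^ p)]; exact abs_sub _ _
      _ ≤ _ := by linarith
  obtain ⟨C, hC0, hC⟩ := tendsto_of_riccati hα0 hc0 hcm
    -- The solution of the cancellation condition for the 1/r terms.
    (d := k * c * α / ((1 + α) * lam)) (by rw [← hlam]; field_simp) hz hzc (lt_min hp one_lt_two)
    (min_le_right _ _) hE hgz (fun r hr => hpos r (hRp r hr))
  refine ⟨C, hC0, ?_⟩
  have hb : α * c ^ (α - 1) * (k * c * α / ((1 + α) * lam)) = k / (p * (p - 1)) := by
    have h1 : c ^ (α - 1) * c = lam := by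
      rw [Real.rpow_sub_one hc0.ne', div_mul_cancel₀ _ hc0.ne']
    calc _ = α * α * k * (c ^ (α - 1) * c) / ((1 + α) * lam) := by ring
      _ = _ := by rw [h1, hα]; field_simp; ring
  rwa [hb, ← hlam, hcα] at hC

/-! ### Strict positivity of the profile and its vanishing at infinity. -/

theorem rpow_mul_rpow_le {a b p : ℝ} (hp : 1 < p) (ha : 0 ≤ a) (hb : 0 ≤ b) :
    a * b ^ (p - 1) ≤ a ^ p + b ^ p := by
  have h : ∀ x : ℝ, 0 ≤ x → x * x ^ (p - 1) = x ^ p := fun x hx => by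
    rw [mul_comm, ← Real.rpow_add_one' hx (by linarith), sub_add_cancel]
  rcases le_total a b with hab | hab
  · calc a * b ^ (p - 1) ≤ b * b ^ (p - 1) := by gcongr
      _ = b ^ p := h b hb
      _ ≤ _ := by have := Real.rpow_nonneg ha p; linarith
  · calc a * b ^ (p - 1) ≤ a * a ^ (p - 1) := by gcongr
      _ = a ^ p := h a ha
      _ ≤ _ := by have := Real.rpow_nonneg hb p; linarith

theorem apply_zero_of_abs_le_rpow {f : ℝ → ℝ} (hf : Continuous f) {A s : ℝ} (hs : 0 < s)
    (h : ∀ᶠ t in 𝓝[>] 0, |f t| ≤ A * t ^ s) : f 0 = 0 := by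
  have h1 : Tendsto (fun t => |f t|) (𝓝[>] 0) (𝓝 |f 0|) :=
    (hf.abs.tendsto 0).mono_left nhdsWithin_le_nhds
  have h2 : Tendsto (fun t : ℝ => A * t ^ s) (𝓝[>] 0) (𝓝 0) := by
    have : Tendsto (fun t : ℝ => A * t ^ s) (𝓝 0) (𝓝 (A * 0 ^ s)) :=
      ((Real.continuousAt_rpow_const 0 s (Or.inr hs.le)).tendsto).const_mul A
    rw [Real.zero_rpow hs.ne', mul_zero] at this
    exact this.mono_left nhdsWithin_le_nhds
  exact abs_eq_zero.1 (le_antisymm (le_of_tendsto_of_tendsto h1 h2 h) (abs_nonneg _))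

/-- Near zero q > p suffices, and away from zero compactness does. The exponent p - 1 matches the
homogeneity of the p-Laplacian, which makes the energy inequality in the maximum principle linear.
-/
theorem exists_abs_le_rpow_on_Icc {f : ℝ → ℝ} (hf : Continuous f) {A p q : ℝ} (hp : 1 < p)
    (hq : p < q) (h : ∀ᶠ t in 𝓝[>] 0, |f t| ≤ A * t ^ (q - 1)) (S : ℝ) :
    ∃ C, 0 ≤ C ∧ ∀ t ∈ Set.Icc 0 S, |f t| ≤ C * t ^ (p - 1) := by
  have hf0 := apply_zero_of_abs_le_rpow hf (by linarith) h
  obtain ⟨δ, hδ, hball⟩ := mem_nhdsGT_iff_exists_Ioo_subset.1 h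
  obtain ⟨B, hB⟩ := isCompact_Icc.exists_bound_of_continuousOn (s := Set.Icc 0 S) hf.continuousOn
  set η := min δ 1 with hη
  have hη0 : 0 < η := lt_min hδ one_pos
  refine ⟨|A| + |B| / η ^ (p - 1), by positivity, fun t ht => ?_⟩
  rcases ht.1.eq_or_lt with h0 | h0
  · rw [← h0, hf0, abs_zero]; positivity
  rcases lt_or_ge t η with h1 | h1
  · have ht1 : t ≤ 1 := h1.le.trans (min_le_right _ _)
    calc |f t| ≤ A * t ^ (q - 1) := hball ⟨h0, h1.trans_le (min_le_left _ _)⟩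
      _ ≤ |A| * t ^ (q - 1) := by gcongr; exact le_abs_self A
      _ ≤ |A| * t ^ (p - 1) := by
        gcongr ?_ * ?_
        exact Real.rpow_le_rpow_of_exponent_ge h0 ht1 (by linarith)
      _ ≤ _ := by
        have : 0 ≤ |B| / η ^ (p - 1) := by positivity
        gcongr; linarith
  · calc |f t| ≤ B := hB t ht
      _ ≤ |B| := le_abs_self B
      _ = |B| / η ^ (p - 1) * η ^ (p - 1) := by
        have : η ^ (p - 1) ≠ 0 := (Real.rpow_pos_of_pos hη0 _).ne'
        field_simp
      _ ≤ |B| / η ^ (p - 1) * t ^ (p - 1) := by gcongr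
      _ ≤ _ := by
        have := abs_nonneg A
        gcongr; linarith

/-- Strong maximum principle for the radial `p`-Laplace equation: a nonnegative solution with a
zero vanishes to the right of it. -/
theorem eq_zero_of_radial_ode {k p μ m q A r₀ : ℝ} {f g w : ℝ → ℝ} (hp : 1 < p)
    (hq : p < q) (hfc : Continuous f)
    (hf : ∀ᶠ t in 𝓝[>] 0, |f t| ≤ A * t ^ (q - 1))
    (hg : ∀ r > 0, HasDerivAt g (|w r| ^ (1 / (p - 1) - 1) * w r) r)
    (hw : ∀ r > 0, HasDerivAt w
      (-(k / r) * w r + ((m - μ / r ^ p) * g r ^ (p - 1) - f (g r))) r)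
    (hnn : ∀ r > 0, 0 ≤ g r) (hr₀ : 0 < r₀) (hgr₀ : g r₀ = 0) :
    ∀ r ∈ Set.Icc r₀ (r₀ + 1), g r = 0 := by
  have hp1 : 0 < p - 1 := by linarith
  set α := 1 / (p - 1) with hα
  have hα0 : 0 < α := by positivity
  -- A zero of a nonnegative function is an interior minimum, so g', and with it the flux, vanishes
  -- there.
  have hwr₀ : w r₀ = 0 := by
    have hmin : IsLocalMin g r₀ := by
      filter_upwards [Ioi_mem_nhds hr₀] with r hr
      rw [hgr₀]; exact hnn r hr
    have h1 := hmin.hasDerivAt_eq_zero (hg r₀ hr₀)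
    by_contra h2
    have : 0 < |w r₀| ^ (α - 1) := Real.rpow_pos_of_pos (abs_pos.2 h2) _
    exact (mul_ne_zero this.ne' h2) h1
  have hpos : ∀ r ∈ Set.Icc r₀ (r₀ + 1), 0 < r := fun r hr => hr₀.trans_le hr.1
  have hgc : ContinuousOn g (Set.Icc r₀ (r₀ + 1)) := fun r hr =>
    (hg r (hpos r hr)).continuousAt.continuousWithinAt
  obtain ⟨S, hS⟩ := isCompact_Icc.exists_bound_of_continuousOn hgc
  obtain ⟨C, hC0, hC⟩ := exists_abs_le_rpow_on_Icc hfc hp hq hf S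
  have hVc : ContinuousOn (fun r : ℝ => m - μ / r ^ p) (Set.Icc r₀ (r₀ + 1)) := by
    refine continuousOn_const.sub (continuousOn_const.div ?_ ?_)
    · exact continuousOn_id.rpow_const fun r hr => Or.inl (hpos r hr).ne'
    · exact fun r hr => (Real.rpow_pos_of_pos (hpos r hr) _).ne'
  obtain ⟨V, hV⟩ := isCompact_Icc.exists_bound_of_continuousOn hVc
  have hV0 : 0 ≤ V := (norm_nonneg _).trans (hV r₀ ⟨le_rfl, by linarith⟩)
  set L := (1 + α) * (|k| / r₀ + V + C) + p with hL
  -- The system need not be Lipschitz at the origin, but the energy |w|^{1+α} + g^p does satisfy a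
  -- linear inequality: 1 + α is the conjugate exponent of p, so Young's inequality controls every
  -- mixed term |w|^α g^{p-1}.
  have hgron := norm_le_gronwallBound_of_norm_deriv_right_le
    (f := fun r => |w r| ^ (1 + α) + g r ^ p)
    (f' := fun r => (1 + α) * |w r| ^ (1 + α - 2) * w r *
      (-(k / r) * w r + ((m - μ / r ^ p) * g r ^ (p - 1) - f (g r)))
      + |w r| ^ (α - 1) * w r * p * g r ^ (p - 1)) (δ := 0) (K := L) (ε := 0) (a := r₀)
    (b := r₀ + 1) ?_ ?_ ?_ ?_
  · intro r hr
    have h1 := hgron r hr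
    rw [gronwallBound_ε0_δ0] at h1
    have h2 := norm_le_zero_iff.1 h1
    have h3 : 0 ≤ |w r| ^ (1 + α) := by positivity
    have h4 := hnn r (hpos r hr)
    have h5 : 0 ≤ g r ^ p := by positivity
    exact (Real.rpow_eq_zero h4 (by linarith : p ≠ 0)).1 (by linarith)
  · intro r hr
    have h1 : ContinuousAt (fun r => |w r| ^ (1 + α)) r :=
      (hw r (hpos r hr)).continuousAt.abs.rpow_const (Or.inr (by linarith))
    have h2 : ContinuousAt (fun r => g r ^ p) r :=
      (hg r (hpos r hr)).continuousAt.rpow_const (Or.inr (by linarith))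
    exact (h1.add h2).continuousWithinAt
  · intro r hr
    have hr' := hpos r ⟨hr.1, hr.2.le⟩
    have h1 := (hasDerivAt_abs_rpow (w r) (p := 1 + α) (by linarith)).comp r (hw r hr')
    have h2 := (hg r hr').rpow_const (p := p) (Or.inr hp.le)
    exact (h1.fun_add h2).hasDerivWithinAt
  · simp [hgr₀, hwr₀, Real.zero_rpow (by linarith : p ≠ 0), Real.zero_rpow (by linarith : 1 + α ≠ 0)]
  · intro r hr
    have hr' : r ∈ Set.Icc r₀ (r₀ + 1) := ⟨hr.1, hr.2.le⟩
    have hrp := hpos r hr'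
    have hgr := hnn r hrp
    set G := g r ^ (p - 1) with hG
    have hG0 : 0 ≤ G := by positivity
    set W := |w r| with hW
    have hW0 : 0 ≤ W := abs_nonneg _
    set E := W ^ (1 + α) + g r ^ p with hE
    have hE0 : 0 ≤ E := by positivity
    have hrhs : |-(k / r) * w r + ((m - μ / r ^ p) * G - f (g r))|
        ≤ |k| / r₀ * W + (V + C) * G := by
      have h1 : |-(k / r) * w r| ≤ |k| / r₀ * W := by
        rw [abs_mul, abs_neg, abs_div, abs_of_pos hrp]; gcongr; exact hr.1
      have h2 : |(m - μ / r ^ p) * G| ≤ V * G := by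
        rw [abs_mul, abs_of_nonneg hG0]; gcongr; exact hV r hr'
      have h3 : |f (g r)| ≤ C * G :=
        hC _ ⟨hgr, (le_abs_self _).trans (hS r hr')⟩
      calc _ ≤ |-(k / r) * w r| + (|(m - μ / r ^ p) * G| + |f (g r)|) :=
            (abs_add_le _ _).trans (add_le_add le_rfl (abs_sub _ _))
        _ ≤ _ := by linarith
    have hWα : W ^ (1 + α - 2) * W = W ^ α := by
      rw [← Real.rpow_add_one' hW0 (by ring_nf; linarith)]; congr 1; ring
    have hWα' : W ^ (α - 1) * W = W ^ α := by
      rw [← Real.rpow_add_one' hW0 (by linarith), sub_add_cancel]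
    have hWW : W ^ α * W = W ^ (1 + α) := by
      rw [← Real.rpow_add_one' hW0 (by linarith), add_comm]
    have hmix : W ^ α * G ≤ E := by
      have h1 := rpow_mul_rpow_le hp (Real.rpow_nonneg hW0 α) hgr
      have h2 : (W ^ α) ^ p = W ^ (1 + α) := by
        rw [← Real.rpow_mul hW0]; congr 1; rw [hα]; field_simp; ring
      rwa [h2] at h1
    have hWE : W ^ (1 + α) ≤ E := by
      have : 0 ≤ g r ^ p := by positivity
      linarith
    have hkr0 : 0 ≤ |k| / r₀ := by positivity
    rw [Real.norm_eq_abs, Real.norm_eq_abs, abs_of_nonneg hE0, add_zero]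
    calc _ ≤ |(1 + α) * W ^ (1 + α - 2) * w r *
          (-(k / r) * w r + ((m - μ / r ^ p) * G - f (g r)))| +
          |W ^ (α - 1) * w r * p * G| := abs_add_le _ _
      _ = (1 + α) * W ^ α * |-(k / r) * w r + ((m - μ / r ^ p) * G - f (g r))| +
          p * (W ^ α * G) := by
        have e1 : |(1 + α) * W ^ (1 + α - 2) * w r| = (1 + α) * W ^ α := by
          rw [abs_mul, abs_mul, abs_of_nonneg (Real.rpow_nonneg hW0 (1 + α - 2)),
            abs_of_pos (by linarith : 0 < 1 + α), ← hW, mul_assoc, hWα]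
        have e2 : |W ^ (α - 1) * w r * p * G| = p * (W ^ α * G) := by
          rw [abs_mul, abs_mul, abs_mul, abs_of_nonneg (Real.rpow_nonneg hW0 (α - 1)), ← hW, hWα',
            abs_of_nonneg hG0, abs_of_pos (by linarith : 0 < p)]; ring
        rw [abs_mul, e1, e2]
      _ ≤ (1 + α) * W ^ α * (|k| / r₀ * W + (V + C) * G) + p * (W ^ α * G) := by gcongr
      _ = (1 + α) * (|k| / r₀ * W ^ (1 + α) + (V + C) * (W ^ α * G)) + p * (W ^ α * G) := by
        rw [← hWW]; ring
      _ ≤ (1 + α) * (|k| / r₀ * E + (V + C) * E) + p * E := by gcongr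
      _ = L * E := by rw [hL]; ring

theorem nonneg_of_ae_pos {g : ℝ → ℝ} (hg : ContinuousOn g (Set.Ioi 0))
    (h : ∀ᵐ r ∂(volume.restrict (Set.Ioi (0 : ℝ))), 0 < g r) : ∀ r > 0, 0 ≤ g r := by
  rw [ae_restrict_iff' measurableSet_Ioi] at h
  have hopen : IsOpen (Set.Ioi 0 ∩ g ⁻¹' Set.Iio 0) :=
    hg.isOpen_inter_preimage isOpen_Ioi isOpen_Iio
  have hnull : volume (Set.Ioi 0 ∩ g ⁻¹' Set.Iio 0) = 0 := by
    refine measure_mono_null ?_ h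
    rintro r ⟨h1, h2⟩ h3
    exact lt_asymm (h3 h1) h2
  intro r hr
  by_contra! hlt
  have := (hopen.measure_eq_zero_iff volume).1 hnull
  exact Set.notMem_empty r (this ▸ ⟨hr, hlt⟩)

/-- One zero would force zeros on an interval of length one, a set of positive measure. -/
theorem pos_of_radial_ode {k p μ m q A : ℝ} {f g w : ℝ → ℝ} (hp : 1 < p)
    (hq : p < q) (hfc : Continuous f)
    (hf : ∀ᶠ t in 𝓝[>] 0, |f t| ≤ A * t ^ (q - 1))
    (hg : ∀ r > 0, HasDerivAt g (|w r| ^ (1 / (p - 1) - 1) * w r) r)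
    (hw : ∀ r > 0, HasDerivAt w
      (-(k / r) * w r + ((m - μ / r ^ p) * g r ^ (p - 1) - f (g r))) r)
    (hnn : ∀ r > 0, 0 ≤ g r)
    (hpos : ∀ᵐ r ∂(volume.restrict (Set.Ioi (0 : ℝ))), 0 < g r) : ∀ r > 0, 0 < g r := by
  intro r₀ hr₀
  refine (hnn r₀ hr₀).lt_of_ne' fun h0 => ?_
  have h1 := eq_zero_of_radial_ode hp hq hfc hf hg hw hnn hr₀ h0
  rw [ae_restrict_iff' measurableSet_Ioi] at hpos
  have h2 : volume (Set.Icc r₀ (r₀ + 1)) = 0 := by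
    refine measure_mono_null ?_ hpos
    intro r hr h3
    exact (h3 (hr₀.trans_le hr.1)).ne' (h1 r hr)
  simp at h2

/-- The derivative p g^{p-1} g' of g^p is integrable by Young's inequality, and an integrable
function with integrable derivative tends to zero. -/
theorem tendsto_zero_of_integrableOn_rpow {g g' : ℝ → ℝ} {p : ℝ} (hp : 1 < p)
    (hg : ∀ r > 0, HasDerivAt g (g' r) r) (hgc' : ContinuousOn g' (Set.Ioi 0))
    (hnn : ∀ r > 0, 0 ≤ g r)
    (h1 : IntegrableOn (fun r => g r ^ p) (Set.Ioi 1))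
    (h2 : IntegrableOn (fun r => |g' r| ^ p) (Set.Ioi 1)) : Tendsto g atTop (𝓝 0) := by
  have hsub : Set.Ioi (1 : ℝ) ⊆ Set.Ioi 0 := Set.Ioi_subset_Ioi zero_le_one
  have hder : ∀ r ∈ Set.Ioi (1 : ℝ),
      HasDerivAt (fun r => g r ^ p) (g' r * p * g r ^ (p - 1)) r := fun r hr =>
    (hg r (hsub hr)).rpow_const (Or.inr hp.le)
  have hgc : ContinuousOn g (Set.Ioi 1) := fun r hr =>
    (hg r (hsub hr)).continuousAt.continuousWithinAt
  have hint : IntegrableOn (fun r => g' r * p * g r ^ (p - 1)) (Set.Ioi 1) := by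
    refine Integrable.mono' ((h2.add h1).const_mul p) ?_ ?_
    · refine ContinuousOn.aestronglyMeasurable ?_ measurableSet_Ioi
      exact ((hgc'.mono hsub).mul continuousOn_const).mul
        (hgc.rpow_const fun r _ => Or.inr (by linarith))
    · filter_upwards [ae_restrict_mem measurableSet_Ioi] with r hr
      have h0 := hnn r (hsub hr)
      have := rpow_mul_rpow_le hp (abs_nonneg (g' r)) h0
      rw [Real.norm_eq_abs, abs_mul, abs_mul, abs_of_pos (by linarith : 0 < p),
        abs_of_nonneg (Real.rpow_nonneg h0 _)]
      simp only [Pi.add_apply]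
      nlinarith
  have hlim := tendsto_zero_of_hasDerivAt_of_integrableOn_Ioi hder hint h1
  have h3 := hlim.rpow_const (p := 1 / p) (Or.inr (by positivity))
  rw [Real.zero_rpow (by positivity)] at h3
  refine h3.congr' ?_
  filter_upwards [eventually_gt_atTop 0] with r hr
  rw [← Real.rpow_mul (hnn r hr), mul_one_div_cancel (by linarith), Real.rpow_one]

/-! ### Weak derivatives on the half line. -/

/-- Smooth functions on the line with compact support in `(0, ∞)`. -/
structure IsRadialTest (η : ℝ → ℝ) : Prop where
  contDiff : ContDiff ℝ ∞ η
  hasCompactSupport : HasCompactSupport η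
  tsupport_subset : tsupport η ⊆ Set.Ioi 0

namespace IsRadialTest

variable {η θ : ℝ → ℝ}

/-- The interval is enlarged to contain 1, the base point of the primitives of locally integrable
functions used below. -/
theorem exists_tsupport_subset_Ioo (h : IsRadialTest η) :
    ∃ a b : ℝ, 0 < a ∧ a < 1 ∧ 1 < b ∧ tsupport η ⊆ Set.Ioo a b := by
  rcases (tsupport η).eq_empty_or_nonempty with h0 | h0
  · exact ⟨1 / 2, 2, by norm_num, by norm_num, by norm_num, by simp [h0]⟩
  obtain ⟨x, hx, hxmin⟩ := h.hasCompactSupport.isCompact.exists_isLeast h0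
  obtain ⟨y, hy, hymax⟩ := h.hasCompactSupport.isCompact.exists_isGreatest h0
  have hx0 : 0 < x := h.tsupport_subset hx
  refine ⟨min (x / 2) (1 / 2), max (y + 1) 2, by positivity,
    (min_le_right _ _).trans_lt (by norm_num), lt_of_lt_of_le (by norm_num) (le_max_right _ _),
    fun t ht => ⟨?_, ?_⟩⟩
  · have h1 : x ≤ t := hxmin ht
    exact (min_le_left _ _).trans_lt (by linarith)
  · have h1 : t ≤ y := hymax ht
    exact lt_of_lt_of_le (by linarith) (le_max_left _ _)

theorem of_eq_zero {a b : ℝ} (ha : 0 < a) (hη : ContDiff ℝ ∞ η)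
    (h : ∀ r, r ∉ Set.Icc a b → η r = 0) : IsRadialTest η := by
  have hsub : tsupport η ⊆ Set.Icc a b :=
    closure_minimal (fun r hr => by_contra fun h1 => hr (h r h1)) isClosed_Icc
  exact ⟨hη, isCompact_Icc.of_isClosed_subset (isClosed_tsupport η) hsub,
    fun r hr => ha.trans_le (hsub hr).1⟩

theorem smooth_mul (h : IsRadialTest η) (hθ : ContDiffOn ℝ ∞ θ (Set.Ioi 0)) :
    IsRadialTest (fun r => θ r * η r) := by
  refine ⟨contDiff_iff_contDiffAt.2 fun r => ?_, h.hasCompactSupport.mul_left, ?_⟩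
  · by_cases hr : r ∈ tsupport η
    · exact (hθ.contDiffAt (Ioi_mem_nhds (h.tsupport_subset hr))).mul h.contDiff.contDiffAt
    · have h1 : η =ᶠ[𝓝 r] 0 := notMem_tsupport_iff_eventuallyEq.1 hr
      have h2 : (fun r => θ r * η r) =ᶠ[𝓝 r] fun _ => 0 := by
        filter_upwards [h1] with x hx
        simp [hx]
      exact contDiffAt_const.congr_of_eventuallyEq h2
  · exact (tsupport_mul_subset_right (f := θ)).trans h.tsupport_subset

theorem eq_zero_of_notMem (_h : IsRadialTest η) {r : ℝ} (hr : r ∉ tsupport η) : η r = 0 :=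
  image_eq_zero_of_notMem_tsupport hr

theorem deriv_eq_zero_of_notMem (_h : IsRadialTest η) {r : ℝ} (hr : r ∉ tsupport η) :
    deriv η r = 0 :=
  image_eq_zero_of_notMem_tsupport fun h1 => hr (tsupport_deriv_subset h1)

theorem continuous_deriv (h : IsRadialTest η) : Continuous (deriv η) :=
  h.contDiff.continuous_deriv (by simp)

theorem integrable (h : IsRadialTest η) : Integrable η :=
  h.contDiff.continuous.integrable_of_hasCompactSupport h.hasCompactSupport

theorem integrable_mul (h : IsRadialTest η) {l : ℝ → ℝ}
    (hl : LocallyIntegrableOn l (Set.Ioi 0)) {ζ : ℝ → ℝ} (hζ : Continuous ζ)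
    (h0 : ∀ r, r ∉ tsupport η → ζ r = 0) : Integrable (fun r => l r * ζ r) := by
  have h1 : IntegrableOn l (tsupport η) :=
    hl.integrableOn_compact_subset h.tsupport_subset h.hasCompactSupport.isCompact
  have h2 := h1.mul_continuousOn hζ.continuousOn h.hasCompactSupport.isCompact
  refine (integrableOn_iff_integrable_of_support_subset fun r hr => ?_).1 h2
  by_contra h3
  exact hr (by simp [h0 r h3])

/-- Vanishing mean is what makes the primitive vanish again to the right of the support. -/
theorem antideriv (h : IsRadialTest η) (h0 : ∫ r, η r = 0) :
    IsRadialTest (fun r => ∫ s in (0 : ℝ)..r, η s) ∧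
      deriv (fun r => ∫ s in (0 : ℝ)..r, η s) = η := by
  have hder : ∀ r, HasDerivAt (fun r => ∫ s in (0 : ℝ)..r, η s) (η r) r := fun r =>
    h.contDiff.continuous.integral_hasStrictDerivAt 0 r |>.hasDerivAt
  have hderiv : deriv (fun r => ∫ s in (0 : ℝ)..r, η s) = η := funext fun r => (hder r).deriv
  refine ⟨?_, hderiv⟩
  obtain ⟨a, b, ha, ha1, hb, hab⟩ := h.exists_tsupport_subset_Ioo
  refine of_eq_zero (a := a) (b := b) ha
    (contDiff_infty_iff_deriv.2 ⟨fun r => (hder r).differentiableAt, by rw [hderiv]; exact h.contDiff⟩)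
    fun r hr => ?_
  have hz : ∀ s, s ∉ Set.Ioo a b → η s = 0 := fun s hs => h.eq_zero_of_notMem fun h1 => hs (hab h1)
  rw [Set.mem_Icc, not_and_or, not_le, not_le] at hr
  rcases hr with hr | hr
  · rw [intervalIntegral.integral_congr (g := fun _ => 0)]
    · simp
    · intro s hs
      refine hz s fun h1 => ?_
      have : s ≤ max 0 r := hs.2
      have : max 0 r < a := max_lt ha hr
      linarith [h1.1]
  · rw [← h0]
    refine intervalIntegral.integral_eq_integral_of_support_subset fun s hs => ?_
    by_contra h1
    exact hs (hz s fun h2 => h1 ⟨by linarith [h2.1], by linarith [h2.2]⟩)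

theorem sub_const_mul (h : IsRadialTest η) (h' : IsRadialTest θ) (c : ℝ) :
    IsRadialTest (fun r => η r - c * θ r) := by
  obtain ⟨a, b, ha, -, -, hab⟩ := h.exists_tsupport_subset_Ioo
  obtain ⟨a', b', ha', -, -, hab'⟩ := h'.exists_tsupport_subset_Ioo
  refine of_eq_zero (a := min a a') (b := max b b') (lt_min ha ha')
    (h.contDiff.sub (contDiff_const.mul h'.contDiff)) fun r hr => ?_
  rw [h.eq_zero_of_notMem fun h1 => hr ⟨(min_le_left _ _).trans (hab h1).1.le,
      (hab h1).2.le.trans (le_max_left _ _)⟩,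
    h'.eq_zero_of_notMem fun h1 => hr ⟨(min_le_right _ _).trans (hab' h1).1.le,
      (hab' h1).2.le.trans (le_max_right _ _)⟩]
  simp

end IsRadialTest

theorem exists_isRadialTest_integral_eq_one : ∃ η, IsRadialTest η ∧ ∫ r, η r = 1 := by
  let φ : ContDiffBump (1 : ℝ) := ⟨1 / 4, 1 / 2, by norm_num, by norm_num⟩
  refine ⟨φ.normed volume, ⟨φ.contDiff_normed, φ.hasCompactSupport_normed, ?_⟩,
    φ.integral_normed⟩
  rw [φ.tsupport_normed_eq, Real.closedBall_eq_Icc]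
  intro r hr
  have : (1 : ℝ) - 1 / 2 ≤ r := hr.1
  exact lt_of_lt_of_le (by norm_num) this

/-- The lemma of du Bois-Reymond. -/
theorem exists_ae_eq_const_of_integral_deriv_eq_zero {h : ℝ → ℝ}
    (hh : LocallyIntegrableOn h (Set.Ioi 0))
    (h0 : ∀ η, IsRadialTest η → ∫ r, h r * deriv η r = 0) :
    ∃ c, ∀ᵐ r, r ∈ Set.Ioi (0 : ℝ) → h r = c := by
  obtain ⟨η₀, hη₀, hη₀1⟩ := exists_isRadialTest_integral_eq_one
  refine ⟨∫ r, h r * η₀ r, ?_⟩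
  set c := ∫ r, h r * η₀ r with hc
  have key := isOpen_Ioi.ae_eq_zero_of_integral_contDiff_smul_eq_zero (μ := volume)
    (U := Set.Ioi (0 : ℝ)) (f := fun r => h r - c)
    (hh.sub (continuous_const.locallyIntegrable.locallyIntegrableOn _)) ?_
  · filter_upwards [key] with r hr hr0
    exact sub_eq_zero.1 (hr hr0)
  intro η h1 h2 h3
  have hη : IsRadialTest η := ⟨h1, h2, h3⟩
  -- Subtracting (∫η) η₀ leaves mean zero, hence the derivative of a test function; this also
  -- explains the value of `c`.
  obtain ⟨hθ, hθ'⟩ := (hη.sub_const_mul hη₀ (∫ r, η r)).antideriv (by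
    rw [integral_sub hη.integrable (hη₀.integrable.const_mul _), integral_const_mul, hη₀1]; ring)
  have h4 := h0 _ hθ
  rw [hθ'] at h4
  have i1 := hη.integrable_mul hh hη.contDiff.continuous fun r hr => hη.eq_zero_of_notMem hr
  have i2 := hη₀.integrable_mul hh hη₀.contDiff.continuous fun r hr => hη₀.eq_zero_of_notMem hr
  calc ∫ r, η r • (h r - c) = ∫ r, (h r * η r - c * η r) := by
        congr 1; ext r; simp only [smul_eq_mul]; ring
    _ = (∫ r, h r * η r) - c * ∫ r, η r := by
        rw [integral_sub i1 (hη.integrable.const_mul _), integral_const_mul]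
    _ = ∫ r, (h r * η r - (∫ r, η r) * (h r * η₀ r)) := by
        rw [integral_sub i1 (i2.const_mul _), integral_const_mul, ← hc]; ring
    _ = ∫ r, h r * (η r - (∫ r, η r) * η₀ r) := by congr 1; ext r; ring
    _ = 0 := h4

theorem LocallyIntegrableOn.intervalIntegrable_of_pos {l : ℝ → ℝ}
    (hl : LocallyIntegrableOn l (Set.Ioi 0)) {a b : ℝ} (ha : 0 < a) (hb : 0 < b) :
    IntervalIntegrable l volume a b :=
  (hl.integrableOn_compact_subset (fun _ hr => (lt_min ha hb).trans_le hr.1)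
    isCompact_uIcc).intervalIntegrable

/-- Integration by parts for absolutely continuous functions on an interval around the support; the
boundary terms vanish with η. -/
theorem integral_primitive_mul_deriv {l η : ℝ → ℝ} (hl : LocallyIntegrableOn l (Set.Ioi 0))
    (hη : IsRadialTest η) :
    ∫ r, (∫ s in (1 : ℝ)..r, l s) * deriv η r = - ∫ r, l r * η r := by
  obtain ⟨a, b, ha, ha1, hb, hab⟩ := hη.exists_tsupport_subset_Ioo
  have hb0 : 0 < b := by linarith
  have hli := LocallyIntegrableOn.intervalIntegrable_of_pos hl ha hb0
  have hF := hli.absolutelyContinuousOnInterval_intervalIntegral (c := 1)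
    (by rw [Set.uIcc_of_le (by linarith)]; exact ⟨ha1.le, hb.le⟩)
  have hG : AbsolutelyContinuousOnInterval η a b :=
    ContDiffOn.absolutelyContinuousOnInterval ((hη.contDiff.of_le (by simp)).contDiffOn)
  have h1 := hF.integral_mul_deriv_eq_deriv_mul hG
  have hsupp : ∀ ζ : ℝ → ℝ, (∀ r, r ∉ tsupport η → ζ r = 0) →
      ∫ r in a..b, ζ r = ∫ r, ζ r := by
    intro ζ hζ
    refine intervalIntegral.integral_eq_integral_of_support_subset fun r hr => ?_
    by_contra h2
    exact hr (hζ r fun h3 => h2 ⟨(hab h3).1, (hab h3).2.le⟩)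
  have ha0 : η a = 0 := hη.eq_zero_of_notMem fun h => lt_irrefl _ (hab h).1
  have hb0' : η b = 0 := hη.eq_zero_of_notMem fun h => lt_irrefl _ (hab h).2
  rw [ha0, hb0', mul_zero, mul_zero, sub_zero, zero_sub, hsupp _ fun r hr => by
    rw [hη.deriv_eq_zero_of_notMem hr, mul_zero]] at h1
  rw [h1, ← hsupp _ fun r hr => by rw [hη.eq_zero_of_notMem hr, mul_zero]]
  congr 1
  refine intervalIntegral.integral_congr_ae ?_
  filter_upwards [hli.ae_hasDerivAt_integral] with r hr hr'
  rw [(hr (Set.uIoc_subset_uIcc hr') 1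
    (by rw [Set.uIcc_of_le (by linarith)]; exact ⟨ha1.le, hb.le⟩)).deriv]

theorem continuousOn_primitive_Ioi {l : ℝ → ℝ} (hl : LocallyIntegrableOn l (Set.Ioi 0)) :
    ContinuousOn (fun r => ∫ s in (1 : ℝ)..r, l s) (Set.Ioi 0) := by
  intro r hr
  have hr0 : 0 < r := hr
  have h1 : 0 < min (r / 2) 1 := by positivity
  have h2 : 0 < max (r + 1) 1 := by positivity
  have := (LocallyIntegrableOn.intervalIntegrable_of_pos hl h1
    h2).absolutelyContinuousOnInterval_intervalIntegral (c := 1)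
    (by rw [Set.mem_uIcc]; exact Or.inl ⟨min_le_right _ _, le_max_right _ _⟩)
  refine (this.continuousOn.continuousAt ?_).continuousWithinAt
  have h3 := min_le_left (r / 2) 1
  have h4 := le_max_left (r + 1) 1
  rw [Set.uIcc_of_le ((min_le_right _ _).trans (le_max_right _ _))]
  exact Icc_mem_nhds (by linarith) (by linarith)

/-- A function with a locally integrable weak derivative on `(0, ∞)` is a primitive of it. -/
theorem exists_ae_eq_primitive_of_weakDeriv {h l : ℝ → ℝ}
    (hh : LocallyIntegrableOn h (Set.Ioi 0)) (hl : LocallyIntegrableOn l (Set.Ioi 0))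
    (hw : ∀ η, IsRadialTest η → ∫ r, h r * deriv η r = - ∫ r, l r * η r) :
    ∃ c, ∀ᵐ r, r ∈ Set.Ioi (0 : ℝ) → h r = c + ∫ s in (1 : ℝ)..r, l s := by
  have hP : LocallyIntegrableOn (fun r => ∫ s in (1 : ℝ)..r, l s) (Set.Ioi 0) :=
    (continuousOn_primitive_Ioi hl).locallyIntegrableOn measurableSet_Ioi
  obtain ⟨c, hc⟩ := exists_ae_eq_const_of_integral_deriv_eq_zero (hh.sub hP) fun η hη => by
    have i1 := hη.integrable_mul hh hη.continuous_deriv fun r hr => hη.deriv_eq_zero_of_notMem hr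
    have i2 := hη.integrable_mul hP hη.continuous_deriv fun r hr => hη.deriv_eq_zero_of_notMem hr
    simp only [Pi.sub_apply, sub_mul]
    rw [integral_sub i1 i2, hw η hη, integral_primitive_mul_deriv hl hη]; ring
  refine ⟨c, ?_⟩
  filter_upwards [hc] with r hr hr0
  have := hr hr0
  simp only [Pi.sub_apply] at this
  linarith

/-! ### Integration in polar coordinates. -/

theorem locallyIntegrableOn_Ioi_of_Icc {ξ : ℝ → ℝ}
    (h : ∀ a b, 0 < a → IntegrableOn ξ (Set.Icc a b)) : LocallyIntegrableOn ξ (Set.Ioi 0) := by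
  rw [locallyIntegrableOn_iff isOpen_Ioi.isLocallyClosed]
  intro K hK hKc
  rcases K.eq_empty_or_nonempty with h0 | h0
  · simp [h0]
  obtain ⟨a, ha, hmin⟩ := hKc.exists_isLeast h0
  obtain ⟨b, -, hmax⟩ := hKc.exists_isGreatest h0
  exact (h a b (hK ha)).mono_set fun r hr => ⟨hmin hr, hmax hr⟩

theorem exists_norm_mem_Icc_of_tsupport_subset {E : Type*} [NormedAddCommGroup E] {ζ : E → ℝ} (hc : HasCompactSupport ζ)
    (h0 : tsupport ζ ⊆ {0}ᶜ) :
    ∃ a b : ℝ, 0 < a ∧ a < 1 ∧ 1 < b ∧ ∀ x ∈ tsupport ζ, ‖x‖ ∈ Set.Icc a b := by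
  rcases (tsupport ζ).eq_empty_or_nonempty with h1 | h1
  · exact ⟨1 / 2, 2, by norm_num, by norm_num, by norm_num, by simp [h1]⟩
  obtain ⟨x, hx, hxmin⟩ := hc.isCompact.exists_isMinOn h1 continuous_norm.continuousOn
  obtain ⟨y, hy, hymax⟩ := hc.isCompact.exists_isMaxOn h1 continuous_norm.continuousOn
  have hx0 : 0 < ‖x‖ := norm_pos_iff.2 (h0 hx)
  exact ⟨min ‖x‖ (1 / 2), max ‖y‖ 2, by positivity, (min_le_right _ _).trans_lt (by norm_num),
    lt_of_lt_of_le (by norm_num) (le_max_right _ _), fun t ht =>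
      ⟨(min_le_left _ _).trans (hxmin ht), (hymax ht).trans (le_max_left _ _)⟩⟩

theorem integrable_volumeIoiPow_iff (n : ℕ) (F : ℝ → ℝ) :
    Integrable (fun r : Set.Ioi (0 : ℝ) => F r) (Measure.volumeIoiPow n) ↔
      IntegrableOn (fun r => r ^ n * F r) (Set.Ioi 0) := by
  rw [integrableOn_iff_comap_subtypeVal measurableSet_Ioi, Measure.volumeIoiPow,
    integrable_withDensity_iff_integrable_smul', integrable_congr]
  · refine .of_forall ?_
    rintro ⟨x, hx : 0 < x⟩
    simp (disch := positivity) [ENNReal.toReal_ofReal]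
  · fun_prop
  · simp

theorem integral_volumeIoiPow (n : ℕ) (F : ℝ → ℝ) :
    ∫ r : Set.Ioi (0 : ℝ), F r ∂(Measure.volumeIoiPow n) =
      ∫ r in Set.Ioi (0 : ℝ), r ^ n * F r := by
  simp only [Measure.volumeIoiPow, ENNReal.ofReal]
  rw [integral_withDensity_eq_integral_smul,
    integral_subtype_comap measurableSet_Ioi fun a ↦ Real.toNNReal (a ^ n) • F a,
    setIntegral_congr_fun measurableSet_Ioi fun x hx ↦ ?_]
  · rw [NNReal.smul_def, Real.coe_toNNReal _ (pow_nonneg hx.out.le _), smul_eq_mul]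
  · exact (measurable_subtype_coe.pow_const _).real_toNNReal

section Polar

variable {E : Type*} [NormedAddCommGroup E] [NormedSpace ℝ E] [MeasurableSpace E]

/-- The integral of `Φ` over the sphere of radius `r`, with the surface measure of that sphere. -/
noncomputable def sphericalIntegral (ν : Measure E) (Φ : E → ℝ) (r : ℝ) : ℝ :=
  r ^ (Module.finrank ℝ E - 1) * ∫ θ : Metric.sphere (0 : E) 1, Φ (r • (θ : E)) ∂ν.toSphere

theorem sphericalIntegral_radial_mul (ν : Measure E) (Φ : E → ℝ) (ψ : ℝ → ℝ) {r : ℝ}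
    (hr : 0 < r) :
    sphericalIntegral ν (fun x => Φ x * ψ ‖x‖) r = sphericalIntegral ν Φ r * ψ r := by
  simp only [sphericalIntegral, mul_assoc]
  rw [← integral_mul_const]
  congr 2
  ext θ
  simp [norm_smul, abs_of_pos hr]

variable [BorelSpace E] [FiniteDimensional ℝ E]

theorem integrable_prod_polar (ν : Measure E) [ν.IsAddHaarMeasure] {Φ : E → ℝ}
    (hΦ : Integrable Φ ν) :
    Integrable (fun x : Metric.sphere (0 : E) 1 × Set.Ioi (0 : ℝ) => Φ (x.2.1 • (x.1 : E)))
      (ν.toSphere.prod (Measure.volumeIoiPow (Module.finrank ℝ E - 1))) := by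
  rw [← ν.measurePreserving_homeomorphUnitSphereProd.integrable_comp_emb
    (Homeomorph.measurableEmbedding _)]
  have h1 : Integrable (Φ ∘ ((↑) : ({0}ᶜ : Set E) → E)) (ν.comap (↑)) :=
    (integrableOn_iff_comap_subtypeVal (measurableSet_singleton _).compl).1 hΦ.integrableOn
  refine h1.congr (ae_of_all _ fun x => ?_)
  have hx : ‖(x : E)‖ ≠ 0 := norm_ne_zero_iff.2 x.2
  simp [smul_smul, hx]

theorem integrableOn_sphericalIntegral (ν : Measure E) [ν.IsAddHaarMeasure] {Φ : E → ℝ}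
    (hΦ : Integrable Φ ν) : IntegrableOn (sphericalIntegral ν Φ) (Set.Ioi 0) :=
  (integrable_volumeIoiPow_iff _ fun r =>
    ∫ θ : Metric.sphere (0 : E) 1, Φ (r • (θ : E)) ∂ν.toSphere).1
    (integrable_prod_polar ν hΦ).integral_prod_right

variable [Nontrivial E]

theorem integral_prod_polar (ν : Measure E) [ν.IsAddHaarMeasure] (Φ : E → ℝ) :
    ∫ x, Φ x ∂ν = ∫ x : Metric.sphere (0 : E) 1 × Set.Ioi (0 : ℝ), Φ (x.2.1 • (x.1 : E))
      ∂(ν.toSphere.prod (Measure.volumeIoiPow (Module.finrank ℝ E - 1))) := by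
  rw [← ν.measurePreserving_homeomorphUnitSphereProd.integral_comp
    (Homeomorph.measurableEmbedding _)]
  calc ∫ x, Φ x ∂ν = ∫ x : ({(0)}ᶜ : Set E), Φ x.1 ∂(ν.comap (↑)) := by
        rw [integral_subtype_comap (measurableSet_singleton _).compl fun x ↦ Φ x,
          restrict_compl_singleton]
    _ = _ := by
        congr 1; ext x
        have hx : ‖(x : E)‖ ≠ 0 := norm_ne_zero_iff.2 x.2
        simp [smul_smul, hx]

theorem integral_sphericalIntegral (ν : Measure E) [ν.IsAddHaarMeasure] {Φ : E → ℝ}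
    (hΦ : Integrable Φ ν) :
    ∫ r in Set.Ioi (0 : ℝ), sphericalIntegral ν Φ r = ∫ x, Φ x ∂ν := by
  rw [integral_prod_polar ν Φ, integral_prod_symm _ (integrable_prod_polar ν hΦ)]
  exact (integral_volumeIoiPow _ fun r =>
    ∫ θ : Metric.sphere (0 : E) 1, Φ (r • (θ : E)) ∂ν.toSphere).symm

/-- A property of the norm holds almost everywhere iff it holds for almost every radius. -/
theorem ae_norm_iff (ν : Measure E) [ν.IsAddHaarMeasure] (Q : ℝ → Prop) :
    (∀ᵐ x ∂ν, Q ‖x‖) ↔ ∀ᵐ r ∂(volume.restrict (Set.Ioi (0 : ℝ))), Q r := by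
  classical
  set d := Module.finrank ℝ E with hd
  -- The indicator of the failure of `Q`. No measurability of `Q` is needed, since the polar
  -- integrability criterion and integral formula hold for every real function of the norm.
  set F : ℝ → ℝ := fun r => if Q r then 0 else 1 with hF
  have hF0 : ∀ r, 0 ≤ F r := fun r => by simp only [hF]; split_ifs <;> norm_num
  have hQF : ∀ r, F r = 0 ↔ Q r := fun r => by simp [hF]
  have hint := integrable_fun_norm_addHaar ν (f := F)
  have heq := integral_fun_norm_addHaar ν F
  have hc : 0 < ν.real (Metric.ball (0 : E) 1) :=
    ENNReal.toReal_pos (Metric.measure_ball_pos ν _ one_pos).ne' measure_ball_lt_top.ne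
  have hdpos : (d : ℝ) ≠ 0 := Nat.cast_ne_zero.2 Module.finrank_pos.ne'
  have h2 : (∀ᵐ r ∂(volume.restrict (Set.Ioi (0 : ℝ))), Q r) ↔
      (fun r => r ^ (d - 1) • F r) =ᵐ[volume.restrict (Set.Ioi (0 : ℝ))] 0 := by
    refine eventually_congr ?_
    filter_upwards [ae_restrict_mem measurableSet_Ioi] with r hr
    have hr0 : r ^ (d - 1) ≠ 0 := (pow_pos hr _).ne'
    rw [← hQF]; simp [hr0]
  have h1 : (∀ᵐ x ∂ν, Q ‖x‖) ↔ (fun x => F ‖x‖) =ᵐ[ν] 0 :=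
    eventually_congr (ae_of_all _ fun x => (hQF _).symm)
  rw [h1, h2]
  constructor
  · intro h
    have hi := hint.1 ((integrable_zero E ℝ ν).congr h.symm)
    rw [integral_eq_zero_of_ae h, nsmul_eq_mul, smul_eq_mul] at heq
    refine (integral_eq_zero_iff_of_nonneg_ae ?_ hi).1 ?_
    · filter_upwards [ae_restrict_mem measurableSet_Ioi] with r hr
      have hr0 : 0 < r := hr
      have := hF0 r
      simp only [Pi.zero_apply, smul_eq_mul]; positivity
    · have h3 := (mul_eq_zero.1 heq.symm).resolve_left hdpos
      exact (mul_eq_zero.1 h3).resolve_left hc.ne'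
  · intro h
    have hi := hint.2 ((integrable_zero ℝ ℝ _).congr h.symm)
    refine (integral_eq_zero_iff_of_nonneg (fun x => hF0 _) hi).1 ?_
    rw [heq, integral_eq_zero_of_ae h]; simp

theorem integrable_indicator_norm (ν : Measure E) [ν.IsAddHaarMeasure] {ξ : ℝ → ℝ}
    (hξ : LocallyIntegrableOn ξ (Set.Ioi 0)) {a b : ℝ} (ha : 0 < a) :
    Integrable (fun x : E => (Set.Icc a b).indicator ξ ‖x‖) ν := by
  rw [integrable_fun_norm_addHaar]
  have h1 : IntegrableOn ξ (Set.Icc a b) :=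
    hξ.integrableOn_compact_subset (fun r hr => ha.trans_le hr.1) isCompact_Icc
  have h2 := h1.continuousOn_mul ((continuous_pow (Module.finrank ℝ E - 1)).continuousOn)
    isCompact_Icc
  have h3 := (integrable_indicator_iff measurableSet_Icc).2 h2
  refine h3.integrableOn.congr_fun (fun r _ => ?_) measurableSet_Ioi
  by_cases hr : r ∈ Set.Icc a b <;> simp [hr]

theorem locallyIntegrableOn_of_integrable_indicator_norm (ν : Measure E) [ν.IsAddHaarMeasure]
    {ξ : ℝ → ℝ}
    (h : ∀ a b, 0 < a → Integrable (fun x : E => (Set.Icc a b).indicator ξ ‖x‖) ν) :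
    LocallyIntegrableOn ξ (Set.Ioi 0) := by
  refine locallyIntegrableOn_Ioi_of_Icc fun a b ha0 => ?_
  have h1 := (integrable_fun_norm_addHaar ν).1 (h a b ha0)
  have h2 := (h1.mono_set (fun r hr => ha0.trans_le hr.1 : Set.Icc a b ⊆ Set.Ioi 0)).continuousOn_mul
    (g := fun r => (r ^ (Module.finrank ℝ E - 1))⁻¹)
    ((continuous_pow _).continuousOn.inv₀ fun r hr => (pow_pos (ha0.trans_le hr.1) _).ne')
    isCompact_Icc
  refine h2.congr_fun (fun r hr => ?_) measurableSet_Icc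
  have : r ^ (Module.finrank ℝ E - 1) ≠ 0 := (pow_pos (ha0.trans_le hr.1) _).ne'
  simp only [smul_eq_mul, Set.indicator_of_mem hr]
  field_simp

theorem integrable_radial_mul (ν : Measure E) [ν.IsAddHaarMeasure] {ξ : ℝ → ℝ}
    (hξ : LocallyIntegrableOn ξ (Set.Ioi 0)) {ζ : E → ℝ} {a b : ℝ} (ha : 0 < a)
    (hm : AEStronglyMeasurable ζ ν) {C : ℝ} (hC : ∀ x, |ζ x| ≤ C)
    (h0 : ∀ x, ‖x‖ ∉ Set.Icc a b → ζ x = 0) :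
    Integrable (fun x => ξ ‖x‖ * ζ x) ν := by
  have h1 := (integrable_indicator_norm ν hξ (b := b) ha).mul_bdd (c := C) hm
    (ae_of_all _ hC)
  refine h1.congr (ae_of_all _ fun x => ?_)
  by_cases hx : ‖x‖ ∈ Set.Icc a b
  · simp [Set.indicator_of_mem hx]
  · simp [h0 x hx]

theorem locallyIntegrableOn_radial_mul (ν : Measure E) [ν.IsAddHaarMeasure] {ξ : ℝ → ℝ}
    (hξ : LocallyIntegrableOn ξ (Set.Ioi 0)) {ζ : E → ℝ}
    (hm : AEStronglyMeasurable ζ ν) {C : ℝ} (hC : ∀ x, |ζ x| ≤ C) :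
    LocallyIntegrableOn (fun x => ξ ‖x‖ * ζ x) {0}ᶜ ν := by
  intro x hx
  have hx0 : 0 < ‖x‖ := norm_pos_iff.2 hx
  have hopen : IsOpen ((fun y : E => ‖y‖) ⁻¹' Set.Ioo (‖x‖ / 2) (‖x‖ + 1)) :=
    isOpen_Ioo.preimage continuous_norm
  refine ⟨_, mem_nhdsWithin_of_mem_nhds (hopen.mem_nhds ⟨by linarith, by linarith⟩), ?_⟩
  have h1 := (integrable_indicator_norm ν hξ (a := ‖x‖ / 2) (b := ‖x‖ + 1)
    (by positivity)).mul_bdd (c := C) hm (ae_of_all _ hC)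
  refine h1.integrableOn.congr_fun (fun y hy => ?_) hopen.measurableSet
  simp only
  rw [Set.indicator_of_mem (Set.Ioo_subset_Icc_self hy)]

end Polar

/-! ### Derivatives of radial functions. -/

section RadialDeriv

variable {E : Type*} [NormedAddCommGroup E]

theorem IsRadialTest.eventually_comp_norm_eq_zero {ψ : ℝ → ℝ} (h : IsRadialTest ψ) : ∀ᶠ x : E in 𝓝 0, ψ ‖x‖ = 0 := by
  obtain ⟨a, b, ha, -, -, hab⟩ := h.exists_tsupport_subset_Ioo
  filter_upwards [Metric.ball_mem_nhds (0 : E) ha] with x hx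
  exact h.eq_zero_of_notMem fun h1 => by
    have := (hab h1).1
    rw [mem_ball_zero_iff] at hx; linarith

theorem IsRadialTest.comp_norm_eq_zero {ψ : ℝ → ℝ} (h : IsRadialTest ψ) :
    ∃ a b : ℝ, 0 < a ∧ ∀ x : E, ‖x‖ ∉ Set.Icc a b → ψ ‖x‖ = 0 := by
  obtain ⟨a, b, ha, -, -, hab⟩ := h.exists_tsupport_subset_Ioo
  exact ⟨a, b, ha, fun x hx => h.eq_zero_of_notMem fun h1 => hx (Set.Ioo_subset_Icc_self (hab h1))⟩

variable [InnerProductSpace ℝ E]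

theorem HasDerivAt.hasFDerivAt_comp_norm {h : ℝ → ℝ} {h' : ℝ} {x : E} (hx : x ≠ 0)
    (hh : HasDerivAt h h' ‖x‖) :
    HasFDerivAt (fun y : E => h ‖y‖) ((h' / ‖x‖) • innerSL ℝ x) x := by
  have hx0 : ‖x‖ ≠ 0 := norm_ne_zero_iff.2 hx
  have h1 : HasFDerivAt (fun y : E => ‖y‖) ((1 / ‖x‖) • innerSL ℝ x) x := by
    have h2 := (hasStrictFDerivAt_norm_sq x).hasFDerivAt.sqrt (pow_ne_zero 2 hx0)
    simp only [Real.sqrt_sq (norm_nonneg _)] at h2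
    convert! h2 using 1
    ext v
    simp
    field_simp
  convert! hh.comp_hasFDerivAt x h1 using 1
  rw [smul_smul]; congr 1; ring

namespace IsRadialTest

variable {ψ : ℝ → ℝ}

theorem contDiff_comp_norm (h : IsRadialTest ψ) : ContDiff ℝ ∞ (fun x : E => ψ ‖x‖) := by
  refine contDiff_iff_contDiffAt.2 fun x => ?_
  by_cases hx : x = 0
  · rw [hx]
    exact contDiffAt_const.congr_of_eventuallyEq h.eventually_comp_norm_eq_zero
  · exact h.contDiff.contDiffAt.comp x (contDiffAt_norm ℝ hx)

theorem hasFDerivAt_comp_norm (h : IsRadialTest ψ) (x : E) :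
    HasFDerivAt (fun y : E => ψ ‖y‖) ((deriv ψ ‖x‖ / ‖x‖) • innerSL ℝ x) x := by
  by_cases hx : x = 0
  · have h1 : HasFDerivAt (fun y : E => ψ ‖y‖) (0 : E →L[ℝ] ℝ) 0 :=
      (hasFDerivAt_const (0 : ℝ) (0 : E)).congr_of_eventuallyEq h.eventually_comp_norm_eq_zero
    simpa [hx] using h1
  · exact (h.contDiff.differentiable (by simp) _).hasDerivAt.hasFDerivAt_comp_norm hx

theorem hasCompactSupport_comp_norm [FiniteDimensional ℝ E] (h : IsRadialTest ψ) :
    HasCompactSupport (fun x : E => ψ ‖x‖) := by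
  obtain ⟨a, b, -, hab⟩ := h.comp_norm_eq_zero (E := E)
  have := FiniteDimensional.proper ℝ E
  refine HasCompactSupport.of_support_subset_isCompact (isCompact_closedBall (0 : E) b)
    fun x hx => ?_
  by_contra h1
  exact hx (hab x fun h2 => h1 (by simpa using h2.2))

theorem gradient_comp_norm [CompleteSpace E] (h : IsRadialTest ψ) (x : E) :
    gradient (fun y : E => ψ ‖y‖) x = (deriv ψ ‖x‖ / ‖x‖) • x := by
  refine HasGradientAt.gradient ?_
  rw [hasGradientAt_iff_hasFDerivAt]
  have h1 : InnerProductSpace.toDual ℝ E ((deriv ψ ‖x‖ / ‖x‖) • x) =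
      (deriv ψ ‖x‖ / ‖x‖) • innerSL ℝ x := by
    ext v
    simp
  rw [h1]
  exact h.hasFDerivAt_comp_norm x

end IsRadialTest

end RadialDeriv

/-! ### Absolute continuity of the profile of a radial Sobolev function. -/

section Euclidean

variable {N : ℕ}

local notation "𝔼" => EuclideanSpace ℝ (Fin N)

theorem IsRadialTest.isTestFunction {ψ : ℝ → ℝ} (h : IsRadialTest ψ) :
    IsTestFunction (fun x : 𝔼 => ψ ‖x‖) :=
  ⟨h.contDiff_comp_norm, h.hasCompactSupport_comp_norm⟩

theorem IsRadialTest.isTestFunction_mul_coord {ψ : ℝ → ℝ} (h : IsRadialTest ψ) (i : Fin N) :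
    IsTestFunction (fun x : 𝔼 => ψ ‖x‖ * x i) :=
  ⟨h.contDiff_comp_norm.mul (EuclideanSpace.proj (𝕜 := ℝ) i).contDiff,
    h.hasCompactSupport_comp_norm.mul_right⟩

theorem IsRadialTest.fderiv_mul_coord {ψ : ℝ → ℝ} (h : IsRadialTest ψ) (i : Fin N) (x : 𝔼) :
    fderiv ℝ (fun x : 𝔼 => ψ ‖x‖ * x i) x (EuclideanSpace.single i 1)
      = ψ ‖x‖ + deriv ψ ‖x‖ / ‖x‖ * (x i * x i) := by
  have h1 := (h.hasFDerivAt_comp_norm x).mul (EuclideanSpace.proj (𝕜 := ℝ) i).hasFDerivAt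
  have h2 : HasFDerivAt (fun x : 𝔼 => ψ ‖x‖ * x i) _ x := h1
  rw [h2.fderiv]
  simp [EuclideanSpace.inner_single_right]
  ring

theorem IsRadialTest.sum_fderiv_mul_coord {ψ : ℝ → ℝ} (h : IsRadialTest ψ) (x : 𝔼) :
    ∑ i, fderiv ℝ (fun x : 𝔼 => ψ ‖x‖ * x i) x (EuclideanSpace.single i 1)
      = N * ψ ‖x‖ + deriv ψ ‖x‖ * ‖x‖ := by
  simp only [h.fderiv_mul_coord]
  rw [Finset.sum_add_distrib, ← Finset.mul_sum]
  have h1 : ∑ i, x i * x i = ‖x‖ * ‖x‖ := by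
    rw [← sq ‖x‖, EuclideanSpace.norm_sq_eq]
    simp [sq]
  rw [h1]
  by_cases hx : ‖x‖ = 0
  · simp [hx]
  · simp; field_simp

theorem IsTestFunction.continuous_fderiv_apply {φ : 𝔼 → ℝ} (h : IsTestFunction φ) (v : 𝔼) :
    Continuous (fun x => fderiv ℝ φ x v) :=
  (h.1.continuous_fderiv (by simp)).clm_apply continuous_const

theorem IsTestFunction.hasCompactSupport_fderiv_apply {φ : 𝔼 → ℝ} (h : IsTestFunction φ) (v : 𝔼) :
    HasCompactSupport (fun x => fderiv ℝ φ x v) :=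
  h.2.fderiv_apply (𝕜 := ℝ) v

theorem MeasureTheory.LocallyIntegrable.integrable_mul_of_hasCompactSupport {u ζ : 𝔼 → ℝ}
    (hu : LocallyIntegrable u) (hζ : Continuous ζ) (hc : HasCompactSupport ζ) :
    Integrable (fun x => u x * ζ x) :=
  hu.integrable_smul_right_of_hasCompactSupport hζ hc

theorem LocallyIntegrable.coord {G : 𝔼 → 𝔼} (hG : LocallyIntegrable G) (i : Fin N) :
    LocallyIntegrable (fun x => G x i) := fun x => by
  obtain ⟨s, hs, h⟩ := hG x
  exact ⟨s, hs, ContinuousLinearMap.integrable_comp (EuclideanSpace.proj (𝕜 := ℝ) i) h⟩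

/-- Test the i-th coordinate with ψ(|x|) x_i and sum over i: the field ψ(|x|) x has divergence Nψ +
rψ'. -/
theorem HasWeakGradient.integral_divergence {u : 𝔼 → ℝ} {G : 𝔼 → 𝔼} (hu : LocallyIntegrable u)
    (hG : LocallyIntegrable G) (h : HasWeakGradient u G) {ψ : ℝ → ℝ} (hψ : IsRadialTest ψ) :
    ∫ x, u x * (N * ψ ‖x‖ + deriv ψ ‖x‖ * ‖x‖) = - ∫ x, inner ℝ (G x) x * ψ ‖x‖ := by
  have h1 : ∀ i, Integrable fun x : 𝔼 =>
      u x * fderiv ℝ (fun x : 𝔼 => ψ ‖x‖ * x i) x (EuclideanSpace.single i 1) := fun i =>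
    hu.integrable_mul_of_hasCompactSupport
      ((hψ.isTestFunction_mul_coord i).continuous_fderiv_apply _)
      ((hψ.isTestFunction_mul_coord i).hasCompactSupport_fderiv_apply _)
  have h2 : ∀ i, Integrable fun x : 𝔼 => G x i * (ψ ‖x‖ * x i) := fun i =>
    (LocallyIntegrable.coord hG i).integrable_mul_of_hasCompactSupport
      (hψ.isTestFunction_mul_coord i).1.continuous (hψ.isTestFunction_mul_coord i).2
  calc ∫ x, u x * (N * ψ ‖x‖ + deriv ψ ‖x‖ * ‖x‖)
      = ∫ x, ∑ i, u x * fderiv ℝ (fun x : 𝔼 => ψ ‖x‖ * x i) x (EuclideanSpace.single i 1) := by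
        congr 1; ext x
        rw [← Finset.mul_sum, hψ.sum_fderiv_mul_coord]
    _ = ∑ i, - ∫ x, G x i * (ψ ‖x‖ * x i) := by
        rw [integral_finsetSum _ fun i _ => h1 i]
        exact Finset.sum_congr rfl fun i _ => h _ (hψ.isTestFunction_mul_coord i) i
    _ = - ∫ x, inner ℝ (G x) x * ψ ‖x‖ := by
        rw [Finset.sum_neg_distrib, ← integral_finsetSum _ fun i _ => h2 i]
        congr 2; ext x
        rw [PiLp.inner_apply, Finset.sum_mul]
        refine Finset.sum_congr rfl fun i _ => ?_
        simp; ring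

theorem locallyIntegrableOn_sphericalIntegral {K : 𝔼 → ℝ} (hK : LocallyIntegrable K) :
    LocallyIntegrableOn (sphericalIntegral volume K) (Set.Ioi 0) := by
  refine locallyIntegrableOn_Ioi_of_Icc fun a b ha => ?_
  have hms : MeasurableSet ((fun x : 𝔼 => ‖x‖) ⁻¹' Set.Icc a b) :=
    measurable_norm measurableSet_Icc
  have h1 : Integrable (fun x : 𝔼 => K x * (Set.Icc a b).indicator (fun _ => (1 : ℝ)) ‖x‖) := by
    have h2 : IntegrableOn K ((fun x : 𝔼 => ‖x‖) ⁻¹' Set.Icc a b) :=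
      (hK.integrableOn_isCompact (isCompact_closedBall (0 : 𝔼) b)).mono_set
        fun x hx => by simpa using hx.2
    refine (h2.integrable_indicator hms).congr (ae_of_all _ fun x => ?_)
    by_cases hx : ‖x‖ ∈ Set.Icc a b
    · simp only [Set.indicator_of_mem hx, mul_one]
      rw [Set.indicator_of_mem (by exact hx)]
    · simp only [Set.indicator_of_notMem hx, mul_zero]
      rw [Set.indicator_of_notMem (by exact hx)]
  have h3 := (integrableOn_sphericalIntegral volume h1).mono_set
    (fun r hr => ha.trans_le hr.1 : Set.Icc a b ⊆ Set.Ioi 0)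
  refine h3.congr_fun (fun r hr => ?_) measurableSet_Icc
  rw [sphericalIntegral_radial_mul _ _ _ (ha.trans_le hr.1), Set.indicator_of_mem hr, mul_one]

theorem IsRadialTest.setIntegral_Ioi_mul {η : ℝ → ℝ} (h : IsRadialTest η) (l : ℝ → ℝ) {ζ : ℝ → ℝ}
    (h0 : ∀ r, r ∉ tsupport η → ζ r = 0) :
    ∫ r in Set.Ioi (0 : ℝ), l r * ζ r = ∫ r, l r * ζ r :=
  setIntegral_eq_integral_of_forall_compl_eq_zero fun r hr => by
    rw [h0 r fun h1 => hr (h.tsupport_subset h1), mul_zero]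

variable [NeZero N]

instance : Nontrivial 𝔼 := by
  have : Nonempty (Fin N) := ⟨0⟩
  infer_instance

theorem locallyIntegrableOn_profile {u : 𝔼 → ℝ} {g : ℝ → ℝ} (hu : LocallyIntegrable u)
    (hg : ∀ᵐ x, u x = g ‖x‖) : LocallyIntegrableOn g (Set.Ioi 0) := by
  refine locallyIntegrableOn_of_integrable_indicator_norm (volume : Measure 𝔼) fun a b _ => ?_
  have hms : MeasurableSet ((fun x : 𝔼 => ‖x‖) ⁻¹' Set.Icc a b) :=
    measurable_norm measurableSet_Icc
  have h2 : IntegrableOn u ((fun x : 𝔼 => ‖x‖) ⁻¹' Set.Icc a b) :=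
    (hu.integrableOn_isCompact (isCompact_closedBall (0 : 𝔼) b)).mono_set
      fun x hx => by simpa using hx.2
  refine (h2.integrable_indicator hms).congr ?_
  filter_upwards [hg] with x hx'
  by_cases hx : ‖x‖ ∈ Set.Icc a b
  · rw [Set.indicator_of_mem (by exact hx), Set.indicator_of_mem hx, hx']
  · rw [Set.indicator_of_notMem (by exact hx), Set.indicator_of_notMem hx]

/-- The profile of a radial Sobolev function is absolutely continuous. -/
theorem HasWeakGradient.exists_profile_eq_primitive {u : 𝔼 → ℝ} {G : 𝔼 → 𝔼} {g : ℝ → ℝ}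
    (hu : LocallyIntegrable u) (hG : LocallyIntegrable G) (h : HasWeakGradient u G)
    (hg : ∀ᵐ x, u x = g ‖x‖) :
    ∃ (c : ℝ) (γ : ℝ → ℝ), LocallyIntegrableOn γ (Set.Ioi 0) ∧
      ∀ᵐ r, r ∈ Set.Ioi (0 : ℝ) → g r = c + ∫ s in (1 : ℝ)..r, γ s := by
  -- The area of the unit sphere.
  set κ : ℝ := N * (volume : Measure 𝔼).real (Metric.ball 0 1) with hκ
  have hκ0 : κ ≠ 0 := mul_ne_zero (Nat.cast_ne_zero.2 (NeZero.ne N))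
    (ENNReal.toReal_pos (Metric.measure_ball_pos volume _ one_pos).ne' measure_ball_lt_top.ne).ne'
  have hK : LocallyIntegrable fun x => inner ℝ (G x) x := by
    have : (fun x => inner ℝ (G x) x) = fun x => ∑ i, x i * G x i := by
      ext x; rw [PiLp.inner_apply]; simp
    rw [this]
    refine locallyIntegrable_finsetSum _ fun i _ => ?_
    rw [← locallyIntegrableOn_univ]
    exact ((LocallyIntegrable.coord hG i).locallyIntegrableOn _).continuousOn_mul
      (EuclideanSpace.proj (𝕜 := ℝ) i).continuous.continuousOn isOpen_univ.isLocallyClosed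
  have hA := locallyIntegrableOn_sphericalIntegral hK
  set A := sphericalIntegral volume fun x : 𝔼 => inner ℝ (G x) x with hAdef
  have hpow : ContDiffOn ℝ ∞ (fun r : ℝ => (r ^ N)⁻¹) (Set.Ioi 0) :=
    (contDiff_id.pow N).contDiffOn.inv fun r hr => (pow_pos hr N).ne'
  -- The mean over the sphere of radius r of the radial component of `G`: one factor r in r^N undoes
  -- the use of x instead of x/|x|, the others undo the surface measure.
  set γ : ℝ → ℝ := fun r => (r ^ N)⁻¹ * A r / κ with hγ
  have hγi : LocallyIntegrableOn γ (Set.Ioi 0) := by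
    have h1 := hA.continuousOn_mul (g := fun r : ℝ => (r ^ N)⁻¹ / κ)
      (hpow.continuousOn.div_const κ) isOpen_Ioi.isLocallyClosed
    refine h1.congr (ae_of_all _ fun r => ?_)
    simp only [hγ]; ring
  suffices hw : ∀ η, IsRadialTest η → ∫ r, g r * deriv η r = - ∫ r, γ r * η r by
    obtain ⟨c, hc⟩ := exists_ae_eq_primitive_of_weakDeriv (locallyIntegrableOn_profile hu hg) hγi hw
    exact ⟨c, γ, hγi, hc⟩
  intro η hη
  -- For ψ = r^{-N} η the divergence is r^{1-N} η', which cancels the polar Jacobian.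
  have hψ := hη.smooth_mul hpow
  have h1 := h.integral_divergence hu hG hψ
  have hfin : Module.finrank ℝ 𝔼 = N := by simp
  have hψi : Integrable (fun x : 𝔼 => inner ℝ (G x) x * ((‖x‖ ^ N)⁻¹ * η ‖x‖)) :=
    hK.integrable_mul_of_hasCompactSupport hψ.contDiff_comp_norm.continuous
      hψ.hasCompactSupport_comp_norm
  have h2 : ∫ x, inner ℝ (G x) x * ((‖x‖ ^ N)⁻¹ * η ‖x‖) = κ * ∫ r, γ r * η r := by
    rw [← integral_sphericalIntegral volume hψi, ← hη.setIntegral_Ioi_mul γ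
      fun r hr => hη.eq_zero_of_notMem hr, ← integral_const_mul]
    refine setIntegral_congr_fun measurableSet_Ioi fun r hr => ?_
    have := sphericalIntegral_radial_mul volume (fun x : 𝔼 => inner ℝ (G x) x)
      (fun r => (r ^ N)⁻¹ * η r) hr
    rw [this, ← hAdef]; simp only [hγ]; field_simp
  have hder : ∀ r : ℝ, 0 < r →
      N * ((r ^ N)⁻¹ * η r) + deriv (fun r => (r ^ N)⁻¹ * η r) r * r
        = (r ^ (N - 1))⁻¹ * deriv η r := by
    intro r hr
    have hd := ((hasDerivAt_pow N r).fun_inv (pow_pos hr N).ne').fun_mul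
      (hη.contDiff.differentiable (by simp) r).hasDerivAt
    rw [hd.deriv]
    have hN : r ^ N = r ^ (N - 1) * r := by
      rw [← pow_succ, Nat.sub_add_cancel NeZero.one_le]
    rw [hN]; field_simp; ring
  have h3 : ∫ x, u x * (N * ((‖x‖ ^ N)⁻¹ * η ‖x‖) + deriv (fun r => (r ^ N)⁻¹ * η r) ‖x‖ * ‖x‖)
      = κ * ∫ r, g r * deriv η r := by
    have h4 : ∫ x, u x * (N * ((‖x‖ ^ N)⁻¹ * η ‖x‖) + deriv (fun r => (r ^ N)⁻¹ * η r) ‖x‖ * ‖x‖)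
        = ∫ x : 𝔼, (fun r => g r * ((r ^ (N - 1))⁻¹ * deriv η r)) ‖x‖ := by
      refine integral_congr_ae ?_
      filter_upwards [hg, Measure.ae_ne volume (0 : 𝔼)] with x hx hx0
      rw [hx, hder _ (norm_pos_iff.2 hx0)]
    rw [h4, integral_fun_norm_addHaar volume fun r => g r * ((r ^ (N - 1))⁻¹ * deriv η r), ← hη.setIntegral_Ioi_mul g
      fun r hr => hη.deriv_eq_zero_of_notMem hr, hfin, nsmul_eq_mul, smul_eq_mul, ← mul_assoc]
    congr 1
    refine setIntegral_congr_fun measurableSet_Ioi fun r hr => ?_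
    have : r ^ (N - 1) ≠ 0 := (pow_pos hr _).ne'
    simp only [smul_eq_mul]; field_simp
  rw [h3, h2, ← mul_neg] at h1
  exact mul_left_cancel₀ hκ0 h1

end Euclidean

/-! ### The weak gradient of a radial function. -/

section Euclidean

variable {N : ℕ}

local notation "𝔼" => EuclideanSpace ℝ (Fin N)

theorem abs_coord_div_norm_le (x : 𝔼) (i : Fin N) : |x i / ‖x‖| ≤ 1 := by
  rw [abs_div, abs_norm]
  exact div_le_one_of_le₀ (PiLp.norm_apply_le x i) (norm_nonneg x)

theorem measurable_coord_div_norm (i : Fin N) : Measurable (fun x : 𝔼 => x i / ‖x‖) :=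
  (EuclideanSpace.proj (𝕜 := ℝ) i).continuous.measurable.div measurable_norm

theorem aestronglyMeasurable_coord_div_norm_mul {φ : 𝔼 → ℝ} (hφ : Continuous φ) (i : Fin N) :
    AEStronglyMeasurable (fun x : 𝔼 => x i / ‖x‖ * φ x) :=
  ((measurable_coord_div_norm i).mul hφ.measurable).aestronglyMeasurable

theorem IsTestFunction.exists_bounds {φ : 𝔼 → ℝ} (hφ : IsTestFunction φ) (i : Fin N) :
    ∃ M, 0 ≤ M ∧ (∀ x, |fderiv ℝ φ x (EuclideanSpace.single i 1)| ≤ M) ∧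
      ∀ x, |x i / ‖x‖ * φ x| ≤ M := by
  obtain ⟨M₁, h1⟩ := (hφ.continuous_fderiv_apply (EuclideanSpace.single i 1)).bounded_above_of_compact_support
    (hφ.hasCompactSupport_fderiv_apply _)
  obtain ⟨M₂, h2⟩ := hφ.1.continuous.bounded_above_of_compact_support hφ.2
  refine ⟨max M₁ M₂, (norm_nonneg _).trans ((h1 0).trans (le_max_left _ _)),
    fun x => (h1 x).trans (le_max_left _ _), fun x => ?_⟩
  rw [abs_mul]
  calc _ ≤ 1 * |φ x| := by gcongr; exact abs_coord_div_norm_le x i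
    _ ≤ _ := by rw [one_mul]; exact (h2 x).trans (le_max_right _ _)

variable [NeZero N]

/-- The continuous case is classical integration by parts: the profile is continuously
differentiable, and the support of φ avoids the origin, where the norm is not differentiable. -/
theorem integral_radial_mul_fderiv_of_continuous {δ : ℝ → ℝ} (hδ : Continuous δ) (c : ℝ)
    {φ : 𝔼 → ℝ} (hφ : IsTestFunction φ) (hφ0 : tsupport φ ⊆ {0}ᶜ) (i : Fin N) :
    ∫ x, (c + ∫ s in (1 : ℝ)..‖x‖, δ s) * fderiv ℝ φ x (EuclideanSpace.single i 1)
      = - ∫ x, δ ‖x‖ * (x i / ‖x‖ * φ x) := by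
  obtain ⟨a, b, ha, -, -, hab⟩ := exists_norm_mem_Icc_of_tsupport_subset hφ.2 hφ0
  obtain ⟨M, -, hM1, hM2⟩ := hφ.exists_bounds i
  set h : ℝ → ℝ := fun r => c + ∫ s in (1 : ℝ)..r, δ s with hh
  have hder : ∀ r, HasDerivAt h (δ r) r := fun r =>
    (hδ.integral_hasStrictDerivAt 1 r).hasDerivAt.const_add c
  have hhc : Continuous h := continuous_iff_continuousAt.2 fun r => (hder r).continuousAt
  have hfd : ∀ x : 𝔼, x ≠ 0 → HasFDerivAt (fun x : 𝔼 => h ‖x‖) _ x := fun x hx =>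
    (hder ‖x‖).hasFDerivAt_comp_norm hx
  have hfdv : ∀ x : 𝔼, fderiv ℝ (fun x : 𝔼 => h ‖x‖) x (EuclideanSpace.single i 1) * φ x
      = δ ‖x‖ * (x i / ‖x‖ * φ x) := by
    intro x
    by_cases hx : x ∈ tsupport φ
    · rw [(hfd x (hφ0 hx)).fderiv]
      simp [EuclideanSpace.inner_single_right]
      ring
    · rw [image_eq_zero_of_notMem_tsupport hx]; simp
  have hloc : ∀ ξ : ℝ → ℝ, Continuous ξ → LocallyIntegrableOn ξ (Set.Ioi 0) := fun ξ hξ =>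
    hξ.locallyIntegrable.locallyIntegrableOn _
  have h0 : ∀ x : 𝔼, ‖x‖ ∉ Set.Icc a b → φ x = 0 := fun x hx =>
    image_eq_zero_of_notMem_tsupport fun h1 => hx (hab x h1)
  have h0' : ∀ x : 𝔼, ‖x‖ ∉ Set.Icc a b → fderiv ℝ φ x (EuclideanSpace.single i 1) = 0 := by
    intro x hx
    have : fderiv ℝ φ x = 0 :=
      image_eq_zero_of_notMem_tsupport fun h1 => hx (hab x (tsupport_fderiv_subset ℝ h1))
    rw [this]; rfl
  obtain ⟨M', hM'⟩ := hφ.1.continuous.bounded_above_of_compact_support hφ.2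
  have i1 : Integrable fun x : 𝔼 => δ ‖x‖ * (x i / ‖x‖ * φ x) :=
    integrable_radial_mul volume (hloc δ hδ) ha
      (aestronglyMeasurable_coord_div_norm_mul hφ.1.continuous i) hM2
      fun x hx => by rw [h0 x hx, mul_zero]
  have := integral_mul_fderiv_eq_neg_fderiv_mul_of_integrable (μ := (volume : Measure 𝔼))
    (f := fun x : 𝔼 => h ‖x‖) (g := φ) (v := EuclideanSpace.single i 1)
    (by simpa only [hfdv] using i1)
    (integrable_radial_mul volume (hloc h hhc) ha
      (hφ.continuous_fderiv_apply _).aestronglyMeasurable hM1 h0')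
    (integrable_radial_mul volume (hloc h hhc) ha hφ.1.continuous.aestronglyMeasurable hM' h0)
    (fun x hx => (hfd x (hφ0 hx)).differentiableAt)
    (fun x _ => hφ.1.differentiable (by simp) x)
  simpa only [hfdv] using this

theorem integral_indicator_norm_le {ξ : ℝ → ℝ} (hξ : Integrable ξ) {a b : ℝ} (hb : 0 ≤ b) :
    ∫ x : 𝔼, (Set.Icc a b).indicator (fun r => |ξ r|) ‖x‖ ≤
      (N * (volume : Measure 𝔼).real (Metric.ball 0 1) * b ^ (N - 1)) * ∫ r, |ξ r| := by
  have hfin : Module.finrank ℝ 𝔼 = N := by simp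
  rw [integral_fun_norm_addHaar volume ((Set.Icc a b).indicator fun r => |ξ r|), hfin,
    nsmul_eq_mul, smul_eq_mul, mul_assoc, mul_assoc]
  gcongr
  rw [← integral_const_mul]
  calc _ ≤ ∫ r in Set.Ioi (0 : ℝ), b ^ (N - 1) * |ξ r| := by
        refine integral_mono_of_nonneg ?_ (hξ.abs.const_mul _).integrableOn ?_
        · filter_upwards [ae_restrict_mem measurableSet_Ioi] with r hr
          have hr0 : 0 < r := hr
          have := Set.indicator_nonneg (s := Set.Icc a b) (fun r _ => abs_nonneg (ξ r)) r
          simp only [Pi.zero_apply, smul_eq_mul]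
          positivity
        · filter_upwards [ae_restrict_mem measurableSet_Ioi] with r hr
          have hr0 : 0 < r := hr
          by_cases hr' : r ∈ Set.Icc a b
          · rw [Set.indicator_of_mem hr', smul_eq_mul]
            gcongr; exact hr'.2
          · rw [Set.indicator_of_notMem hr', smul_zero]; positivity
    _ ≤ _ := setIntegral_le_integral (hξ.abs.const_mul _) (ae_of_all _ fun r => by positivity)

theorem abs_integral_sub_le_of_mem_Icc {γ δ : ℝ → ℝ} {a b : ℝ} (ha1 : a < 1) (hb : 1 < b)
    (hγ : IntegrableOn γ (Set.Icc a b)) (hδ : Integrable δ) {r : ℝ}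
    (hr : r ∈ Set.Icc a b) :
    |(∫ s in (1 : ℝ)..r, γ s) - ∫ s in (1 : ℝ)..r, δ s|
      ≤ ∫ s, |(Set.Icc a b).indicator γ s - δ s| := by
  have h1 : (∫ s in (1 : ℝ)..r, γ s) = ∫ s in (1 : ℝ)..r, (Set.Icc a b).indicator γ s := by
    refine intervalIntegral.integral_congr fun s hs => ?_
    have hs' : s ∈ Set.Icc a b := Set.uIcc_subset_Icc ⟨ha1.le, hb.le⟩ hr hs
    rw [Set.indicator_of_mem hs']
  have hi := hγ.integrable_indicator measurableSet_Icc
  rw [h1, ← intervalIntegral.integral_sub hi.intervalIntegrable hδ.intervalIntegrable]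
  rw [← Real.norm_eq_abs]
  refine intervalIntegral.norm_integral_le_integral_norm_uIoc.trans ?_
  exact setIntegral_le_integral (hi.sub hδ).abs (ae_of_all _ fun r => abs_nonneg _)

/-- A radial function with absolutely continuous profile has the expected weak gradient away from
the origin. -/
theorem integral_radial_mul_fderiv {γ : ℝ → ℝ} (hγ : LocallyIntegrableOn γ (Set.Ioi 0)) (c : ℝ)
    {φ : 𝔼 → ℝ} (hφ : IsTestFunction φ) (hφ0 : tsupport φ ⊆ {0}ᶜ) (i : Fin N) :
    ∫ x, (c + ∫ s in (1 : ℝ)..‖x‖, γ s) * fderiv ℝ φ x (EuclideanSpace.single i 1)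
      = - ∫ x, γ ‖x‖ * (x i / ‖x‖ * φ x) := by
  obtain ⟨a, b, ha, ha1, hb, hab⟩ := exists_norm_mem_Icc_of_tsupport_subset hφ.2 hφ0
  obtain ⟨M, hM0, hM1, hM2⟩ := hφ.exists_bounds i
  set κ := N * (volume : Measure 𝔼).real (Metric.ball 0 1) * b ^ (N - 1) with hκ
  have hκ0 : 0 ≤ κ := by positivity
  set L := (∫ x, |fderiv ℝ φ x (EuclideanSpace.single i 1)|) + M * κ with hL
  have hL0 : 0 ≤ L := add_nonneg (integral_nonneg fun x => abs_nonneg _) (by positivity)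
  have hγab : IntegrableOn γ (Set.Icc a b) :=
    hγ.integrableOn_compact_subset (fun r hr => ha.trans_le hr.1) isCompact_Icc
  have h0 : ∀ x : 𝔼, ‖x‖ ∉ Set.Icc a b → x i / ‖x‖ * φ x = 0 := fun x hx => by
    rw [image_eq_zero_of_notMem_tsupport fun h1 => hx (hab x h1), mul_zero]
  have h0' : ∀ x : 𝔼, ‖x‖ ∉ Set.Icc a b → fderiv ℝ φ x (EuclideanSpace.single i 1) = 0 := by
    intro x hx
    have : fderiv ℝ φ x = 0 :=
      image_eq_zero_of_notMem_tsupport fun h1 => hx (hab x (tsupport_fderiv_subset ℝ h1))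
    rw [this]; rfl
  have hD := (hφ.continuous_fderiv_apply (EuclideanSpace.single i 1))
  have hDi : Integrable fun x => fderiv ℝ φ x (EuclideanSpace.single i 1) :=
    hD.integrable_of_hasCompactSupport (hφ.hasCompactSupport_fderiv_apply _)
  have hm2 := aestronglyMeasurable_coord_div_norm_mul hφ.1.continuous i
  have hprim : ∀ ξ : ℝ → ℝ, LocallyIntegrableOn ξ (Set.Ioi 0) →
      LocallyIntegrableOn (fun r => c + ∫ s in (1 : ℝ)..r, ξ s) (Set.Ioi 0) := fun ξ hξ =>
    (continuousOn_const.add (continuousOn_primitive_Ioi hξ)).locallyIntegrableOn measurableSet_Ioi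
  set D := (∫ x, (c + ∫ s in (1 : ℝ)..‖x‖, γ s) * fderiv ℝ φ x (EuclideanSpace.single i 1))
      + ∫ x, γ ‖x‖ * (x i / ‖x‖ * φ x) with hDdef
  -- Approximate γ on [a, b] within ε in L¹ by a continuous function. The primitives based at 1 then
  -- differ by at most ε uniformly on [a, b], so both integrals change by at most a constant times
  -- ε.
  have key : ∀ ε > 0, |D| ≤ L * ε := by
    intro ε hε
    have hi := hγab.integrable_indicator measurableSet_Icc
    obtain ⟨δ, -, hδε, hδc, hδi⟩ := hi.exists_hasCompactSupport_integral_sub_le hε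
    have hδl : LocallyIntegrableOn δ (Set.Ioi 0) := hδi.locallyIntegrable.locallyIntegrableOn _
    have e0 := integral_radial_mul_fderiv_of_continuous hδc c hφ hφ0 i
    have i1 := integrable_radial_mul volume (hprim γ hγ) ha hD.aestronglyMeasurable hM1 h0'
    have i2 := integrable_radial_mul volume (hprim δ hδl) ha hD.aestronglyMeasurable hM1 h0'
    have i3 := integrable_radial_mul volume hγ ha hm2 hM2 h0
    have i4 := integrable_radial_mul volume hδl ha hm2 hM2 h0
    set ξ : ℝ → ℝ := fun r => (Set.Icc a b).indicator γ r - δ r with hξ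
    have hξi : Integrable ξ := hi.sub hδi
    have e1 : D = (∫ x, ((c + ∫ s in (1 : ℝ)..‖x‖, γ s) * fderiv ℝ φ x (EuclideanSpace.single i 1)
          - (c + ∫ s in (1 : ℝ)..‖x‖, δ s) * fderiv ℝ φ x (EuclideanSpace.single i 1)))
        + ∫ x, (γ ‖x‖ * (x i / ‖x‖ * φ x) - δ ‖x‖ * (x i / ‖x‖ * φ x)) := by
      rw [integral_sub i1 i2, integral_sub i3 i4, e0]; ring
    have e2 : |∫ x, ((c + ∫ s in (1 : ℝ)..‖x‖, γ s) * fderiv ℝ φ x (EuclideanSpace.single i 1)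
          - (c + ∫ s in (1 : ℝ)..‖x‖, δ s) * fderiv ℝ φ x (EuclideanSpace.single i 1))|
        ≤ (∫ x, |fderiv ℝ φ x (EuclideanSpace.single i 1)|) * ε := by
      rw [← integral_mul_const, ← Real.norm_eq_abs]
      refine norm_integral_le_of_norm_le (hDi.abs.mul_const ε) (ae_of_all _ fun x => ?_)
      rw [← sub_mul, Real.norm_eq_abs, abs_mul, mul_comm]
      by_cases hx : ‖x‖ ∈ Set.Icc a b
      · have := abs_integral_sub_le_of_mem_Icc ha1 hb hγab hδi hx
        gcongr
        rw [add_sub_add_left_eq_sub]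
        exact this.trans hδε
      · rw [h0' x hx]; simp
    have e3 : |∫ x, (γ ‖x‖ * (x i / ‖x‖ * φ x) - δ ‖x‖ * (x i / ‖x‖ * φ x))|
        ≤ M * κ * ε := by
      have i5 : Integrable fun x : 𝔼 => (Set.Icc a b).indicator (fun r => |ξ r|) ‖x‖ :=
        integrable_indicator_norm volume (hξi.abs.locallyIntegrable.locallyIntegrableOn _) ha
      calc _ ≤ ∫ x : 𝔼, M * (Set.Icc a b).indicator (fun r => |ξ r|) ‖x‖ := by
            rw [← Real.norm_eq_abs]
            refine norm_integral_le_of_norm_le (i5.const_mul M) (ae_of_all _ fun x => ?_)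
            rw [← sub_mul, Real.norm_eq_abs, abs_mul, mul_comm]
            by_cases hx : ‖x‖ ∈ Set.Icc a b
            · rw [Set.indicator_of_mem hx]
              simp only [hξ, Set.indicator_of_mem hx]
              gcongr; exact hM2 x
            · rw [h0 x hx, Set.indicator_of_notMem hx]; simp
        _ ≤ M * (κ * ε) := by
            rw [integral_const_mul]
            gcongr
            exact (integral_indicator_norm_le hξi (by linarith)).trans (by gcongr; exact hδε)
        _ = _ := by ring
    calc |D| ≤ _ := by rw [e1]; exact abs_add_le _ _
      _ ≤ _ := add_le_add e2 e3
      _ = L * ε := by rw [hL]; ring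
  have hD0 : D = 0 := by
    by_contra hne
    have hpos := abs_pos.2 hne
    have h1 := key (|D| / (2 * (L + 1))) (by positivity)
    have h2 : L * (|D| / (2 * (L + 1))) < |D| := by
      rw [mul_div_assoc', div_lt_iff₀ (by positivity)]
      nlinarith
    linarith
  linarith [hDdef]

/-- The weak gradient of a radial Sobolev function is radial. -/
theorem HasWeakGradient.ae_eq_radial {u : 𝔼 → ℝ} {G : 𝔼 → 𝔼} {γ : ℝ → ℝ} {c : ℝ}
    (hG : LocallyIntegrable G) (h : HasWeakGradient u G)
    (hγ : LocallyIntegrableOn γ (Set.Ioi 0))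
    (hu : ∀ᵐ x, u x = c + ∫ s in (1 : ℝ)..‖x‖, γ s) :
    ∀ᵐ x, G x = (γ ‖x‖ / ‖x‖) • x := by
  have hi : ∀ i, ∀ᵐ x, x ∈ ({0}ᶜ : Set 𝔼) → G x i - γ ‖x‖ * (x i / ‖x‖) = 0 := by
    intro i
    have hr := locallyIntegrableOn_radial_mul volume hγ
      (measurable_coord_div_norm i).aestronglyMeasurable fun x => abs_coord_div_norm_le x i
    refine isOpen_compl_singleton.ae_eq_zero_of_integral_contDiff_smul_eq_zero
      (((LocallyIntegrable.coord hG i).locallyIntegrableOn _).sub hr) fun φ h1 h2 h3 => ?_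
    have hφ : IsTestFunction φ := ⟨h1, h2⟩
    obtain ⟨a, b, ha, -, -, hab⟩ := exists_norm_mem_Icc_of_tsupport_subset h2 h3
    obtain ⟨M, -, -, hM2⟩ := hφ.exists_bounds i
    have i1 := (LocallyIntegrable.coord hG i).integrable_mul_of_hasCompactSupport h1.continuous h2
    have i2 := integrable_radial_mul volume hγ ha
      (aestronglyMeasurable_coord_div_norm_mul h1.continuous i) hM2 (fun x hx => by
        rw [image_eq_zero_of_notMem_tsupport fun h1 => hx (hab x h1), mul_zero])
    have e1 := integral_radial_mul_fderiv hγ c hφ h3 i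
    have e2 := h φ hφ i
    have e3 : ∫ x, u x * fderiv ℝ φ x (EuclideanSpace.single i 1) =
        ∫ x : 𝔼, (c + ∫ s in (1 : ℝ)..‖x‖, γ s) * fderiv ℝ φ x (EuclideanSpace.single i 1) :=
      integral_congr_ae (by filter_upwards [hu] with x hx; rw [hx])
    calc _ = ∫ x, (G x i * φ x - γ ‖x‖ * (x i / ‖x‖ * φ x)) := by
          congr 1; ext x; simp; ring
      _ = 0 := by rw [integral_sub i1 i2]; linarith
  filter_upwards [ae_all_iff.2 hi, Measure.ae_ne volume (0 : 𝔼)] with x hx hx0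
  ext i
  have := hx i hx0
  simp only [PiLp.smul_apply, smul_eq_mul]
  have e : γ ‖x‖ / ‖x‖ * x i = γ ‖x‖ * (x i / ‖x‖) := by ring
  linarith

end Euclidean

/-! ### The signed power `t ↦ |t| ^ (s - 1) * t` -/

/-- In this form continuity at 0 is visible also for s < 1, when the factor |t|^{s-1} alone is
singular. -/
theorem abs_rpow_sub_one_mul_self_eq {s : ℝ} (hs : 0 < s) (t : ℝ) :
    |t| ^ (s - 1) * t = max t 0 ^ s - max (-t) 0 ^ s := by
  rcases lt_trichotomy t 0 with h | h | h
  · rw [abs_of_neg h, max_eq_right h.le, max_eq_left (by linarith), Real.zero_rpow hs.ne',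
      Real.rpow_sub_one (by linarith)]
    have : t ≠ 0 := h.ne
    field_simp; ring
  · simp [h]
  · rw [abs_of_pos h, max_eq_left h.le, max_eq_right (by linarith), Real.zero_rpow hs.ne',
      Real.rpow_sub_one h.ne']
    field_simp; ring

theorem continuous_abs_rpow_sub_one_mul_self {s : ℝ} (hs : 0 < s) :
    Continuous (fun t : ℝ => |t| ^ (s - 1) * t) := by
  simp only [abs_rpow_sub_one_mul_self_eq hs]
  exact ((continuous_id.max continuous_const).rpow_const fun _ => Or.inr hs.le).sub
    ((continuous_id.neg.max continuous_const).rpow_const fun _ => Or.inr hs.le)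

theorem abs_abs_rpow_sub_one_mul_self {s : ℝ} (hs : 0 < s) (t : ℝ) :
    |(|t| ^ (s - 1) * t)| = |t| ^ s := by
  rw [abs_mul, abs_of_nonneg (Real.rpow_nonneg (abs_nonneg t) _),
    ← Real.rpow_add_one' (abs_nonneg t) (by linarith), sub_add_cancel]

/-- Used with s = p - 1 to recover the derivative of the profile from the flux. -/
theorem abs_rpow_sub_one_mul_self_inverse {s s' : ℝ} (hs : 0 < s) (hss' : s * s' = 1) (t : ℝ) :
    |(|t| ^ (s - 1) * t)| ^ (s' - 1) * (|t| ^ (s - 1) * t) = t := by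
  rcases eq_or_ne t 0 with h | h
  · simp [h]
  have h0 : 0 < |t| := abs_pos.2 h
  rw [abs_abs_rpow_sub_one_mul_self hs, ← Real.rpow_mul h0.le, ← mul_assoc, ← Real.rpow_add h0,
    show s * (s' - 1) + (s - 1) = 0 by linear_combination hss', Real.rpow_zero, one_mul]

/-! ### Calculus on the half line -/

theorem hasDerivAt_primitive_Ioi {l : ℝ → ℝ} (hl : ContinuousOn l (Set.Ioi 0)) (c : ℝ) {r : ℝ}
    (hr : 0 < r) : HasDerivAt (fun r => c + ∫ s in (1 : ℝ)..r, l s) (l r) r := by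
  refine HasDerivAt.const_add c ?_
  refine intervalIntegral.integral_hasDerivAt_right
    (LocallyIntegrableOn.intervalIntegrable_of_pos (hl.locallyIntegrableOn measurableSet_Ioi)
      one_pos hr) ?_ (hl.continuousAt (Ioi_mem_nhds hr))
  exact hl.stronglyMeasurableAtFilter isOpen_Ioi r hr

theorem integrableOn_Ioi_one_of_pow_mul {F : ℝ → ℝ} {n : ℕ} (hF : ContinuousOn F (Set.Ioi 0))
    (h0 : ∀ r > 0, 0 ≤ F r) (h : IntegrableOn (fun r => r ^ n * F r) (Set.Ioi 0)) :
    IntegrableOn F (Set.Ioi 1) := by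
  have hsub : Set.Ioi (1 : ℝ) ⊆ Set.Ioi 0 := Set.Ioi_subset_Ioi zero_le_one
  refine Integrable.mono' (h.mono_set hsub)
    ((hF.mono hsub).aestronglyMeasurable measurableSet_Ioi) ?_
  filter_upwards [ae_restrict_mem measurableSet_Ioi] with r hr
  have h1 := h0 r (hsub hr)
  rw [Real.norm_eq_abs, abs_of_nonneg h1]
  exact le_mul_of_one_le_left h1 (one_le_pow₀ (le_of_lt hr))

theorem IsRadialTest.exists_nonneg_dominating {ψ : ℝ → ℝ} (hψ : IsRadialTest ψ) :
    ∃ χ, IsRadialTest χ ∧ (∀ r, 0 ≤ χ r) ∧ ∀ r, 0 ≤ χ r - ψ r := by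
  obtain ⟨a, b, ha, ha1, hb, hab⟩ := hψ.exists_tsupport_subset_Ioo
  obtain ⟨M, hM⟩ := hψ.contDiff.continuous.bounded_above_of_compact_support hψ.hasCompactSupport
  have hM0 : 0 ≤ M := (norm_nonneg _).trans (hM 0)
  -- The inner ball is exactly [a, b], and the outer one starts at a/2, still inside the half line.
  let φ : ContDiffBump ((a + b) / 2) := ⟨(b - a) / 2, b / 2, by linarith, by linarith⟩
  have hφ : IsRadialTest (fun r => M * φ r) := by
    refine IsRadialTest.of_eq_zero (a := a / 2) (b := (a + 2 * b) / 2) (by linarith)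
      (contDiff_const.mul φ.contDiff) fun r hr => ?_
    rw [φ.zero_of_le_dist, mul_zero]
    change b / 2 ≤ _
    rw [Real.dist_eq]
    by_contra! h
    rw [abs_lt] at h
    exact hr ⟨by linarith, by linarith⟩
  refine ⟨_, hφ, fun r => mul_nonneg hM0 φ.nonneg, fun r => ?_⟩
  by_cases hr : r ∈ tsupport ψ
  · have h1 : φ r = 1 := by
      refine φ.one_of_mem_closedBall ?_
      rw [Metric.mem_closedBall, Real.dist_eq]
      change _ ≤ (b - a) / 2
      have := hab hr
      rw [abs_le]; constructor <;> linarith [this.1, this.2]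
    rw [h1]
    have := (le_abs_self _).trans (hM r)
    linarith
  · rw [hψ.eq_zero_of_notMem hr, sub_zero]
    exact mul_nonneg hM0 φ.nonneg

/-- A weak first order equation tested with nonnegative functions holds for all test functions. -/
theorem integral_mul_deriv_eq_neg_of_nonneg {W V : ℝ → ℝ}
    (hW : LocallyIntegrableOn W (Set.Ioi 0)) (hV : LocallyIntegrableOn V (Set.Ioi 0))
    (h : ∀ ψ, IsRadialTest ψ → (∀ r, 0 ≤ ψ r) →
      ∫ r, W r * deriv ψ r = - ∫ r, V r * ψ r) {ψ : ℝ → ℝ} (hψ : IsRadialTest ψ) :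
    ∫ r, W r * deriv ψ r = - ∫ r, V r * ψ r := by
  obtain ⟨χ, hχ, hχ0, hχψ⟩ := hψ.exists_nonneg_dominating
  have hd : IsRadialTest (fun r => χ r - 1 * ψ r) := hχ.sub_const_mul hψ 1
  simp only [one_mul] at hd
  have e1 := h χ hχ hχ0
  have e2 := h _ hd hχψ
  have hder : ∀ r, deriv (fun r => χ r - ψ r) r = deriv χ r - deriv ψ r := fun r =>
    deriv_fun_sub (hχ.contDiff.differentiable (by simp) r) (hψ.contDiff.differentiable (by simp) r)
  have iW : ∀ {η}, IsRadialTest η → Integrable fun r => W r * deriv η r := fun hη =>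
    hη.integrable_mul hW hη.continuous_deriv fun r hr => hη.deriv_eq_zero_of_notMem hr
  have iV : ∀ {η}, IsRadialTest η → Integrable fun r => V r * η r := fun hη =>
    hη.integrable_mul hV hη.contDiff.continuous fun r hr => hη.eq_zero_of_notMem hr
  simp only [hder, mul_sub] at e2
  rw [integral_sub (iW hχ) (iW hψ), integral_sub (iV hχ) (iV hψ)] at e2
  linarith

/-! ### Reduction of the weak equation to an ordinary differential equation. -/

section Euclidean

variable {N : ℕ}

local notation "𝔼" => EuclideanSpace ℝ (Fin N)

theorem norm_div_norm_smul {x : 𝔼} (hx : x ≠ 0) (t : ℝ) : ‖(t / ‖x‖) • x‖ = |t| := by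
  rw [norm_smul, norm_div, norm_norm, div_mul_cancel₀ _ (norm_ne_zero_iff.2 hx), Real.norm_eq_abs]

theorem MemLp.locallyIntegrable_of_one_lt {F : Type*} [NormedAddCommGroup F] {p : ℝ} (hp : 1 < p)
    {u : 𝔼 → F} (hu : MemLp u (ENNReal.ofReal p)) : LocallyIntegrable u :=
  hu.locallyIntegrable (by rw [← ENNReal.ofReal_one]; exact ENNReal.ofReal_le_ofReal hp.le)

theorem MemLp.integrable_norm_rpow_of_pos {F : Type*} [NormedAddCommGroup F] {p : ℝ} (hp : 0 < p)
    {u : 𝔼 → F} (hu : MemLp u (ENNReal.ofReal p)) : Integrable fun x => ‖u x‖ ^ p := by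
  have := hu.integrable_norm_rpow (ENNReal.ofReal_pos.2 hp).ne' ENNReal.ofReal_ne_top
  rwa [ENNReal.toReal_ofReal hp.le] at this

variable [NeZero N]

theorem integrableOn_pow_mul_of_integrable_radial {F : ℝ → ℝ} {Φ : 𝔼 → ℝ} (hΦ : Integrable Φ)
    (h : ∀ᵐ x, Φ x = F ‖x‖) : IntegrableOn (fun r => r ^ (N - 1) * F r) (Set.Ioi 0) := by
  have h1 := (integrable_fun_norm_addHaar (volume : Measure 𝔼) (f := F)).1 (hΦ.congr h)
  simpa using h1

theorem integral_radial_eq {F : ℝ → ℝ} {Φ : 𝔼 → ℝ} (h : ∀ᵐ x, Φ x = F ‖x‖) :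
    ∫ x, Φ x = N * (volume : Measure 𝔼).real (Metric.ball 0 1) *
      ∫ r in Set.Ioi (0 : ℝ), r ^ (N - 1) * F r := by
  rw [integral_congr_ae h, integral_fun_norm_addHaar volume F]
  simp [mul_assoc]

/-- Positivity turns |u|^{p-2} u into P^{p-1}. The exponent is left as p - 1 - 1 to match the signed
power with s = p - 1. -/
theorem hardyForm_radial {p μ m : ℝ} {u : 𝔼 → ℝ} {G : 𝔼 → 𝔼} {P γ ψ : ℝ → ℝ}
    (hψ : IsRadialTest ψ) (hu : ∀ᵐ x, u x = P ‖x‖) (hpos : ∀ᵐ x, 0 < u x)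
    (hG : ∀ᵐ x, G x = (γ ‖x‖ / ‖x‖) • x) :
    hardyForm p μ m u G (fun x => ψ ‖x‖) =
      N * (volume : Measure 𝔼).real (Metric.ball 0 1) *
        ∫ r in Set.Ioi (0 : ℝ), r ^ (N - 1) * (|γ r| ^ (p - 1 - 1) * γ r * deriv ψ r +
          (m - μ / r ^ p) * P r ^ (p - 1) * ψ r) := by
  refine integral_radial_eq (F := fun r => |γ r| ^ (p - 1 - 1) * γ r * deriv ψ r +
    (m - μ / r ^ p) * P r ^ (p - 1) * ψ r) ?_
  filter_upwards [hu, hpos, hG, Measure.ae_ne volume (0 : 𝔼)] with x h1 h2 h3 h4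
  have hx0 : ‖x‖ ≠ 0 := norm_ne_zero_iff.2 h4
  have hin : inner ℝ (G x) (gradient (fun x : 𝔼 => ψ ‖x‖) x) = γ ‖x‖ * deriv ψ ‖x‖ := by
    rw [hψ.gradient_comp_norm, h3, inner_smul_left, inner_smul_right,
      real_inner_self_eq_norm_sq]
    simp only [conj_trivial]
    field_simp
  have hP : 0 < P ‖x‖ := h1 ▸ h2
  have hPp : P ‖x‖ ^ (p - 2) * P ‖x‖ = P ‖x‖ ^ (p - 1) := by
    rw [← Real.rpow_add_one hP.ne']; congr 1; ring
  rw [hin, h3, norm_div_norm_smul h4, h1, abs_of_pos hP, show p - 1 - 1 = p - 2 by ring]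
  linear_combination ((m - μ / ‖x‖ ^ p) * ψ ‖x‖) * hPp

theorem integral_nonlinearity_radial {f : ℝ → ℝ} {u : 𝔼 → ℝ} {P ψ : ℝ → ℝ}
    (hu : ∀ᵐ x, u x = P ‖x‖) :
    ∫ x, f (u x) * ψ ‖x‖ = N * (volume : Measure 𝔼).real (Metric.ball 0 1) *
        ∫ r in Set.Ioi (0 : ℝ), r ^ (N - 1) * (f (P r) * ψ r) := by
  refine integral_radial_eq (F := fun r => f (P r) * ψ r) ?_
  filter_upwards [hu] with x hx
  rw [hx]

/-- A positive radial weak solution solves the radial ordinary differential equation. -/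
theorem IsWeakSolution.exists_radial_ode {p μ m : ℝ} {f : ℝ → ℝ} {u : 𝔼 → ℝ} (hp : 1 < p)
    (hf : Continuous f) (hu : IsWeakSolution p μ m f u) (hpos : ∀ᵐ x, 0 < u x)
    (hrad : IsRadialAE u) :
    ∃ P w : ℝ → ℝ, (∀ᵐ x, u x = P ‖x‖) ∧
      (∀ r > 0, HasDerivAt P (|w r| ^ (1 / (p - 1) - 1) * w r) r) ∧
      (∀ r > 0, HasDerivAt w
        (-(((N : ℝ) - 1) / r) * w r + ((m - μ / r ^ p) * P r ^ (p - 1) - f (P r))) r) ∧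
      (∀ r > 0, 0 ≤ P r) ∧ (∀ᵐ r ∂(volume.restrict (Set.Ioi (0 : ℝ))), 0 < P r) ∧
      Tendsto P atTop (𝓝 0) := by
  obtain ⟨⟨G, hG, hsub⟩, ⟨G', hG', hsup⟩⟩ := hu
  obtain ⟨g, hg⟩ := hrad
  have hp1 : 0 < p - 1 := by linarith
  have hul := MemLp.locallyIntegrable_of_one_lt hp hG.memLp
  have hGl := MemLp.locallyIntegrable_of_one_lt hp hG.memLp_grad
  have hGl' := MemLp.locallyIntegrable_of_one_lt hp hG'.memLp_grad
  obtain ⟨c, γ, hγ, hgγ⟩ := hG.hasWeakGradient.exists_profile_eq_primitive hul hGl hg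
  set P : ℝ → ℝ := fun r => c + ∫ s in (1 : ℝ)..r, γ s with hP
  have huP : ∀ᵐ x, u x = P ‖x‖ := by
    have h1 := (ae_norm_iff (volume : Measure 𝔼) fun r => g r = P r).2
      ((ae_restrict_iff' measurableSet_Ioi).2 hgγ)
    filter_upwards [hg, h1] with x h2 h3
    rw [h2, h3]
  have hPc : ContinuousOn P (Set.Ioi 0) := continuousOn_const.add (continuousOn_primitive_Ioi hγ)
  have hPpos : ∀ᵐ r ∂(volume.restrict (Set.Ioi (0 : ℝ))), 0 < P r := by
    refine (ae_norm_iff (volume : Measure 𝔼) fun r => 0 < P r).1 ?_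
    filter_upwards [hpos, huP] with x h1 h2
    rwa [← h2]
  have hP0 := nonneg_of_ae_pos hPc hPpos
  have hGγ := hG.hasWeakGradient.ae_eq_radial hGl hγ huP
  have hGγ' := hG'.hasWeakGradient.ae_eq_radial hGl' hγ huP
  have hγp : IntegrableOn (fun r => r ^ (N - 1) * |γ r| ^ p) (Set.Ioi 0) := by
    refine integrableOn_pow_mul_of_integrable_radial
      (MemLp.integrable_norm_rpow_of_pos (by linarith) hG.memLp_grad) ?_
    filter_upwards [hGγ, Measure.ae_ne volume (0 : 𝔼)] with x h1 h2
    rw [h1, norm_div_norm_smul h2]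
  have hPp : IntegrableOn (fun r => r ^ (N - 1) * |P r| ^ p) (Set.Ioi 0) := by
    refine integrableOn_pow_mul_of_integrable_radial
      (MemLp.integrable_norm_rpow_of_pos (by linarith) hG.memLp) ?_
    filter_upwards [huP] with x h1
    rw [h1, Real.norm_eq_abs]
  -- In radial form the equation says W' = V weakly, where `V` is already continuous.
  set W : ℝ → ℝ := fun r => r ^ (N - 1) * (|γ r| ^ (p - 1 - 1) * γ r) with hW
  set V : ℝ → ℝ := fun r => r ^ (N - 1) * ((m - μ / r ^ p) * P r ^ (p - 1) - f (P r)) with hV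
  have hVc : ContinuousOn V (Set.Ioi 0) := by
    refine (continuous_pow _).continuousOn.mul (((continuousOn_const.sub
      (continuousOn_const.div ?_ ?_)).mul ?_).sub (hf.comp_continuousOn hPc))
    · exact continuousOn_id.rpow_const fun r hr => Or.inl (ne_of_gt hr)
    · exact fun r hr => (Real.rpow_pos_of_pos hr _).ne'
    · exact hPc.rpow_const fun r _ => Or.inr hp1.le
  have hVl : LocallyIntegrableOn V (Set.Ioi 0) := hVc.locallyIntegrableOn measurableSet_Ioi
  have hWl : LocallyIntegrableOn W (Set.Ioi 0) := by
    have h1 : LocallyIntegrableOn (fun r : ℝ => r ^ (N - 1) + r ^ (N - 1) * |γ r| ^ p)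
        (Set.Ioi 0) :=
      ((continuous_pow _).locallyIntegrable.locallyIntegrableOn _).add hγp.locallyIntegrableOn
    have hm : AEStronglyMeasurable W (volume.restrict (Set.Ioi 0)) := by
      refine (continuous_pow _).aestronglyMeasurable.mul ?_
      exact (continuous_abs_rpow_sub_one_mul_self hp1).comp_aestronglyMeasurable
        hγ.aestronglyMeasurable
    refine locallyIntegrableOn_Ioi_of_Icc fun a b ha => ?_
    have hs : Set.Icc a b ⊆ Set.Ioi 0 := fun r hr => ha.trans_le hr.1
    refine Integrable.mono' (h1.integrableOn_compact_subset hs isCompact_Icc)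
      (hm.mono_measure (Measure.restrict_mono hs le_rfl)) ?_
    filter_upwards [ae_restrict_mem measurableSet_Icc] with r hr
    have hr0 : 0 < r := hs hr
    have h2 : |γ r| ^ (p - 1) ≤ 1 + |γ r| ^ p := by
      have := rpow_mul_rpow_le hp zero_le_one (abs_nonneg (γ r))
      simpa using this
    rw [Real.norm_eq_abs]
    simp only [hW]
    rw [abs_mul, abs_abs_rpow_sub_one_mul_self hp1, abs_of_pos (pow_pos hr0 _)]
    calc _ ≤ r ^ (N - 1) * (1 + |γ r| ^ p) := by gcongr
      _ = _ := by ring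
  have hκ : 0 < N * (volume : Measure 𝔼).real (Metric.ball 0 1) :=
    mul_pos (Nat.cast_pos.2 (NeZero.pos N))
      (ENNReal.toReal_pos (Metric.measure_ball_pos volume _ one_pos).ne' measure_ball_lt_top.ne)
  have hweak : ∀ ψ, IsRadialTest ψ → (∀ r, 0 ≤ ψ r) →
      ∫ r, W r * deriv ψ r = - ∫ r, V r * ψ r := by
    intro ψ hψ hψ0
    have e1 := hsub _ hψ.isTestFunction fun x => hψ0 _
    have e2 := hsup _ hψ.isTestFunction fun x => hψ0 _
    rw [hardyForm_radial hψ huP hpos hGγ] at e1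
    rw [hardyForm_radial hψ huP hpos hGγ'] at e2
    -- The sub- and supersolution conditions carry separate gradients, but both equal the radial
    -- expression in γ almost everywhere, so the inequalities combine.
    have e3 := le_antisymm e1 e2
    rw [integral_nonlinearity_radial huP] at e3
    have e4 := mul_left_cancel₀ hκ.ne' e3
    have iW := hψ.integrable_mul hWl hψ.continuous_deriv fun r hr => hψ.deriv_eq_zero_of_notMem hr
    have iV := hψ.integrable_mul hVl hψ.contDiff.continuous fun r hr => hψ.eq_zero_of_notMem hr
    have hfl : LocallyIntegrableOn (fun r => r ^ (N - 1) * f (P r)) (Set.Ioi 0) :=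
      ((continuous_pow _).continuousOn.mul (hf.comp_continuousOn hPc)).locallyIntegrableOn
        measurableSet_Ioi
    have iF := hψ.integrable_mul hfl hψ.contDiff.continuous fun r hr => hψ.eq_zero_of_notMem hr
    have e5 : ∫ r in Set.Ioi (0 : ℝ), r ^ (N - 1) * (|γ r| ^ (p - 1 - 1) * γ r * deriv ψ r +
          (m - μ / r ^ p) * P r ^ (p - 1) * ψ r) =
        ∫ r in Set.Ioi (0 : ℝ), (W r * deriv ψ r + (V r * ψ r + r ^ (N - 1) * f (P r) * ψ r)) := by
      congr 1; ext r; simp only [hW, hV]; ring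
    have e6 : ∫ r in Set.Ioi (0 : ℝ), r ^ (N - 1) * (f (P r) * ψ r) =
        ∫ r in Set.Ioi (0 : ℝ), r ^ (N - 1) * f (P r) * ψ r := by
      congr 1; ext r; ring
    have iVF : Integrable fun r => V r * ψ r + r ^ (N - 1) * f (P r) * ψ r := iV.add iF
    rw [e5, e6, integral_add iW.integrableOn iVF.integrableOn,
      integral_add iV.integrableOn iF.integrableOn,
      hψ.setIntegral_Ioi_mul W fun r hr => hψ.deriv_eq_zero_of_notMem hr,
      hψ.setIntegral_Ioi_mul V fun r hr => hψ.eq_zero_of_notMem hr] at e4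
    linarith
  obtain ⟨c', hc'⟩ := exists_ae_eq_primitive_of_weakDeriv hWl hVl fun ψ hψ =>
    integral_mul_deriv_eq_neg_of_nonneg hWl hVl hweak hψ
  set Y : ℝ → ℝ := fun r => c' + ∫ s in (1 : ℝ)..r, V s with hY
  have hYd : ∀ r > 0, HasDerivAt Y (V r) r := fun r hr => hasDerivAt_primitive_Ioi hVc c' hr
  -- The differentiable representative of the flux |γ|^{p-2} γ; inverting the signed power then
  -- gives a continuous representative Γ of γ.
  set w : ℝ → ℝ := fun r => Y r * (r ^ (N - 1))⁻¹ with hw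
  have hwd : ∀ r > 0, HasDerivAt w
      (-(((N : ℝ) - 1) / r) * w r + ((m - μ / r ^ p) * P r ^ (p - 1) - f (P r))) r := by
    intro r hr
    refine ((hYd r hr).fun_mul ((hasDerivAt_pow (N - 1) r).fun_inv (pow_pos hr _).ne')).congr_deriv ?_
    have hr0 : r ^ (N - 1) ≠ 0 := (pow_pos hr _).ne'
    -- The truncated exponent N - 1 - 1 matters only for N = 1, where both sides vanish.
    have h1 : (((N - 1 : ℕ) : ℝ)) * r ^ (N - 1 - 1) = ((N : ℝ) - 1) / r * r ^ (N - 1) := by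
      rw [Nat.cast_sub NeZero.one_le, Nat.cast_one]
      rcases Nat.eq_zero_or_pos (N - 1) with h | h
      · have : (N : ℝ) = 1 := by
          have : N = 1 := by have := NeZero.pos N; omega
          exact_mod_cast this
        simp [this]
      · have : r ^ (N - 1) = r ^ (N - 1 - 1) * r := by rw [← pow_succ, Nat.sub_add_cancel h]
        rw [this]; field_simp
    rw [h1]
    simp only [hV, hw]
    field_simp
    ring
  have hwc : ContinuousOn w (Set.Ioi 0) := fun r hr =>
    (hwd r hr).continuousAt.continuousWithinAt
  have hα0 : 0 < 1 / (p - 1) := by positivity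
  set Γ : ℝ → ℝ := fun r => |w r| ^ (1 / (p - 1) - 1) * w r with hΓ
  have hΓc : ContinuousOn Γ (Set.Ioi 0) :=
    (continuous_abs_rpow_sub_one_mul_self hα0).comp_continuousOn hwc
  have hγΓ : ∀ᵐ r, r ∈ Set.Ioi (0 : ℝ) → γ r = Γ r := by
    filter_upwards [hc'] with r h1 hr
    have hr0 : r ^ (N - 1) ≠ 0 := (pow_pos hr _).ne'
    have h2 : w r = |γ r| ^ (p - 1 - 1) * γ r := by
      simp only [hw]
      have h3 : W r = Y r := h1 hr
      rw [← h3]; simp only [hW]; field_simp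
    simp only [hΓ]
    rw [h2, abs_rpow_sub_one_mul_self_inverse hp1 (mul_one_div_cancel hp1.ne')]
  have hPΓ : ∀ r > 0, P r = c + ∫ s in (1 : ℝ)..r, Γ s := by
    intro r hr
    simp only [hP]
    congr 1
    refine intervalIntegral.integral_congr_ae ?_
    filter_upwards [hγΓ] with s h1 hs
    exact h1 ((lt_min one_pos hr).trans hs.1)
  have hPd : ∀ r > 0, HasDerivAt P (Γ r) r := fun r hr =>
    (hasDerivAt_primitive_Ioi hΓc c hr).congr_of_eventuallyEq (by
      filter_upwards [Ioi_mem_nhds hr] with s hs using hPΓ s hs)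
  refine ⟨P, w, huP, hPd, hwd, hP0, hPpos, ?_⟩
  refine tendsto_zero_of_integrableOn_rpow hp hPd hΓc hP0 ?_ ?_
  · refine integrableOn_Ioi_one_of_pow_mul (n := N - 1)
      (hPc.rpow_const fun r _ => Or.inr (by linarith))
      (fun r hr => Real.rpow_nonneg (hP0 r hr) _) ?_
    refine hPp.congr_fun (fun r hr => ?_) measurableSet_Ioi
    simp only [abs_of_nonneg (hP0 r hr)]
  · refine integrableOn_Ioi_one_of_pow_mul (n := N - 1)
      (hΓc.abs.rpow_const fun r _ => Or.inr (by linarith))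
      (fun r _ => Real.rpow_nonneg (abs_nonneg _) _) ?_
    refine hγp.congr ?_
    filter_upwards [(ae_restrict_iff' measurableSet_Ioi).2 hγΓ] with r hr
    rw [hr]

end Euclidean

/-! ### Asymptotics of the weak solution. -/

/-- The slack in A + 1 makes the limsup bound strict, hence valid eventually. -/
theorem eventually_abs_le_rpow_of_limsup_le {f : ℝ → ℝ} {s A : ℝ}
    (h : limsup (fun t : ℝ => ((|f t| / |t| ^ s : ℝ) : EReal)) (𝓝[≠] 0) ≤ A) :
    ∀ᶠ t in 𝓝[>] 0, |f t| ≤ (A + 1) * t ^ s := by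
  have h1 : limsup (fun t : ℝ => ((|f t| / |t| ^ s : ℝ) : EReal)) (𝓝[≠] 0) < ((A + 1 : ℝ) : EReal) :=
    h.trans_lt (EReal.coe_lt_coe_iff.2 (by linarith))
  have h2 := (eventually_lt_of_limsup_lt h1).filter_mono
    (nhdsWithin_mono 0 fun t (ht : 0 < t) => ne_of_gt ht : 𝓝[>] (0 : ℝ) ≤ 𝓝[≠] 0)
  filter_upwards [h2, self_mem_nhdsWithin] with t ht ht0
  have ht0 : 0 < t := ht0
  have h3 := EReal.coe_lt_coe_iff.1 ht
  rw [abs_of_pos ht0, div_lt_iff₀ (Real.rpow_pos_of_pos ht0 s)] at h3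
  exact h3.le

theorem theorem1p2 (N : ℕ) (p q m μ A : ℝ) (f : ℝ → ℝ)
    (u : EuclideanSpace ℝ (Fin N) → ℝ)
    (hp : 1 < p) (hpN : p < N) (hm : 0 < m)
    (hμ : 0 ≤ μ) (hμ' : μ < ((N - p) / p) ^ p)
    (hf : Continuous f) (hq : p < q) (hA : 0 < A)
    (hf_zero : limsup (fun t : ℝ => ((|f t| / |t| ^ (q - 1) : ℝ) : EReal)) (𝓝[≠] 0) ≤ A)
    (hf_infty : limsup (fun t : ℝ => ((|f t| / |t| ^ (N * p / (N - p) - 1) : ℝ) : EReal))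
      (cocompact ℝ) ≤ A)
    (hu : IsWeakSolution p μ m f u)
    (hu_pos : ∀ᵐ x, 0 < u x) (hu_rad : IsRadialAE u) :
    ∃ v : EuclideanSpace ℝ (Fin N) → ℝ, v =ᵐ[volume] u ∧ ContinuousOn v {0}ᶜ ∧
      ∃ C : ℝ, 0 < C ∧
        Tendsto (fun x => v x * ‖x‖ ^ ((N - 1) / (p * (p - 1)))
          * Real.exp ((m / (p - 1)) ^ (1 / p) * ‖x‖))
          (cocompact (EuclideanSpace ℝ (Fin N))) (𝓝 C) := by
  have hN1 : (1 : ℝ) < N := hp.trans hpN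
  have : NeZero N := ⟨fun h => by rw [h] at hN1; norm_num at hN1⟩
  have hf0 := eventually_abs_le_rpow_of_limsup_le hf_zero
  obtain ⟨P, w, huP, hPd, hwd, hP0, hPpos, hlim⟩ := hu.exists_radial_ode hp hf hu_pos hu_rad
  have hP := pos_of_radial_ode hp hq hf hf0 hPd hwd hP0 hPpos
  obtain ⟨C, hC0, hC⟩ := tendsto_of_radial_ode hp (by linarith) hm hq hf0 hPd hwd hP hlim
  -- The representative is the absolutely continuous profile composed with the norm; its value at
  -- the origin plays no role.
  refine ⟨fun x => P ‖x‖, ?_, ?_, C, hC0, ?_⟩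
  · filter_upwards [huP] with x hx using hx.symm
  · intro x hx
    exact ((hPd _ (norm_pos_iff.2 hx)).continuousAt.comp (f := fun x => ‖x‖)
      continuous_norm.continuousAt).continuousWithinAt
  · exact hC.comp (tendsto_norm_cocompact_atTop (E := EuclideanSpace ℝ (Fin N)))
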